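/- Let $\lambda_B>0$, $P_S>0$, $\alpha>2$ and $\sigma\in\mathbb R$. Let the base stations (BSs) $\Phi_B=\{b_1,b_2,\dots\}$ form a homogeneous Poisson point process of density $\lambda_B$ on the Euclidean plane $\mathbb R^2$, and let the fading coefficients $h_1,h_2,\dots$ of the links to $b_1,b_2,\dots$ be i.i.d. exponential random variables of mean $1$, independent of $(b_i)_{i\ge1}$. Consider a typical user at a fixed location $z\in\mathbb R^2$ (for instance the origin). Put $r_i=|z-b_i|$, let $k$ be the (almost surely unique) index of the BS nearest to $z$, which serves the user, and let $R=r_k$ be its distance. Define $$\mathrm{SINR}=\frac{P_S\,h_k\,r_k^{-\alpha}}{\sigma^2+\sum_{i\ne k}P_S\,h_i\,r_i^{-\alpha}},\qquad C=\log_2(1+\mathrm{SINR}).$$ Then $R$ and $C$ are random variables and, for almost every $r_1$ with respect to the law of $R$, the conditional distribution of $C$ given $R=r_1$ satisfies, for all $t\ge 0$, $$\mathbb P(C\ge t\mid R=r_1)=\exp\!\Big(-\frac{(2^t-1)\,r_1^{\alpha}\,\sigma^2}{P_S}-\pi\lambda_B r_1^2\,\rho(2^t-1)\Big),$$ where $\rho(x)=x^{2/\alpha}\int_{x^{-2/\alpha}}^{\infty}\frac{du}{1+u^{\alpha/2}}$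 for $x>0$ and $\rho(0)=0$. -/

import Mathlib

open MeasureTheory ProbabilityTheory
open scoped NNReal ENNReal

noncomputable section

/-- Number (with multiplicity) of points of the sequence `b 0 ω, b 1 ω, …` that lie in `A`. -/
def pointCount {Ω E : Type*} (b : ℕ → Ω → E) (A : Set E) (ω : Ω) : ℕ∞ :=
  {i : ℕ | b i ω ∈ A}.encard

/-- The random points `b 0, b 1, …` of the Euclidean plane enumerate a homogeneous Poisson point
process of density `lam`: the number of points in a Borel set of finite area is Poisson distributed
with mean `lam` times the area, and the numbers of points in finitely many pairwise disjoint
Borel sets are independent. The order of the enumeration is arbitrary. -/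
structure IsHomogeneousPPP {Ω : Type*} [MeasurableSpace Ω]
    (b : ℕ → Ω → EuclideanSpace ℝ (Fin 2)) (lam : ℝ≥0) (μ : Measure Ω) : Prop where
  measurable : ∀ i, Measurable (b i)
  hasLaw_count : ∀ A : Set (EuclideanSpace ℝ (Fin 2)), MeasurableSet A → volume A ≠ ∞ →
    HasLaw (pointCount b A)
      ((poissonMeasure (lam * (volume A).toNNReal)).map (Nat.cast : ℕ → ℕ∞)) μ
  indep_count : ∀ (n : ℕ) (A : Fin n → Set (EuclideanSpace ℝ (Fin 2))),
    (∀ j, MeasurableSet (A j)) → (∀ j k, j ≠ k → Disjoint (A j) (A k)) →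
    iIndepFun (fun j => pointCount b (A j)) μ

/-- The fading coefficients `h i` of the links to the base stations `b i` are i.i.d. exponential
variables of mean `1`, independent of the positions of the base stations. -/
structure IsRayleighFading {Ω : Type*} [MeasurableSpace Ω]
    (h : ℕ → Ω → ℝ) (b : ℕ → Ω → EuclideanSpace ℝ (Fin 2)) (μ : Measure Ω) : Prop where
  measurable : ∀ i, Measurable (h i)
  hasLaw : ∀ i, HasLaw (h i) (expMeasure 1) μ
  iIndep : iIndepFun h μ
  indep_positions : IndepFun (fun ω i => h i ω) (fun ω i => b i ω) μ

/-- Index of the base station nearest to the user at `z` (the first such index; for a Poisson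
point process, almost surely exactly one index qualifies). -/
def servingIndex {Ω : Type*} (z : EuclideanSpace ℝ (Fin 2))
    (b : ℕ → Ω → EuclideanSpace ℝ (Fin 2)) (ω : Ω) : ℕ :=
  sInf {k : ℕ | ∀ i, dist z (b k ω) ≤ dist z (b i ω)}

/-- Distance from the user at `z` to its serving (nearest) base station. -/
def servingDist {Ω : Type*} (z : EuclideanSpace ℝ (Fin 2))
    (b : ℕ → Ω → EuclideanSpace ℝ (Fin 2)) (ω : Ω) : ℝ :=
  dist z (b (servingIndex z b ω) ω)

/-- Power received by the user at `z` from the base station `b i`, with transmission power `P`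
and path loss exponent `α`. -/
def rxPower {Ω : Type*} (P α : ℝ) (z : EuclideanSpace ℝ (Fin 2))
    (b : ℕ → Ω → EuclideanSpace ℝ (Fin 2)) (h : ℕ → Ω → ℝ) (i : ℕ) (ω : Ω) : ℝ :=
  P * h i ω * dist z (b i ω) ^ (-α)

/-- Aggregate interference: total power received from all non-serving base stations
(`∞` if the series diverges). -/
def interference {Ω : Type*} (P α : ℝ) (z : EuclideanSpace ℝ (Fin 2))
    (b : ℕ → Ω → EuclideanSpace ℝ (Fin 2)) (h : ℕ → Ω → ℝ) (ω : Ω) : ℝ≥0∞ :=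
  ∑' i : ℕ, if i = servingIndex z b ω then 0 else ENNReal.ofReal (rxPower P α z b h i ω)

/-- Signal to interference and noise ratio of the user at `z`, with noise power `σ ^ 2`. -/
def sinr {Ω : Type*} (P α σ : ℝ) (z : EuclideanSpace ℝ (Fin 2))
    (b : ℕ → Ω → EuclideanSpace ℝ (Fin 2)) (h : ℕ → Ω → ℝ) (ω : Ω) : ℝ≥0∞ :=
  ENNReal.ofReal (rxPower P α z b h (servingIndex z b ω) ω) /
    (ENNReal.ofReal (σ ^ 2) + interference P α z b h ω)

/-- Link capacity `log₂ (1 + SINR)`. -/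
def linkCapacity {Ω : Type*} (P α σ : ℝ) (z : EuclideanSpace ℝ (Fin 2))
    (b : ℕ → Ω → EuclideanSpace ℝ (Fin 2)) (h : ℕ → Ω → ℝ) (ω : Ω) : ℝ :=
  Real.logb 2 (1 + (sinr P α σ z b h ω).toReal)

/-- `ρ(x) = x ^ (2/α) ∫_{x ^ (-2/α)}^∞ du / (1 + u ^ (α/2))`; its value at `x = 0` is `0`. -/
def rho (α x : ℝ) : ℝ :=
  x ^ (2 / α) * ∫ u in Set.Ioi (x ^ (-(2 / α))), 1 / (1 + u ^ (α / 2))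

end

/-! Write `C` for the capacity, `R` for the serving distance, `r i` for the distance to the `i`-th
station, `k` for the serving index and `x = 2 ^ t - 1`. For `t > 0` the event `t ≤ C` says that
`h k` is at least `x R ^ α σ² / P` plus the sum of `x (R / r i) ^ α h i` over `i ≠ k`
(`le_linkCapacity_iff`). Given the positions, `h k` is
exponential and independent of the other coefficients, so this has probability
`exp (-x R ^ α σ² / P) ∏ 1 / (1 + x (R / r i) ^ α)`
(`IsRayleighFading.measure_tsum_le`), which is written below with the logarithm of the product as
an `[0, ∞]`-valued sum, so that convergence is never an issue.

It remains to average over the positions, given `R`. The Laplace functional of a Poisson process,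
`E exp (-∑ g (b i)) = exp (-λ ∫ (1 - exp (-g)))` (`IsHomogeneousPPP.laplace`), holds for simple `g`
by independence of the counts in disjoint sets, and for measurable `g` with values in `[0, ∞]` by
monotone convergence. As `g = ∞` on a disc forces the disc to be empty, it also gives the
independence of `min R r` from the points at distance at least `r`; approximating `R` by dyadic
numbers yields that, given `R`, the farther points are Poisson outside the disc of radius `R`
(`IsHomogeneousPPP.laplace_given_servingDist`). Almost surely no two points are equidistant from the
user (`IsHomogeneousPPP.ae_dist_injective`), so these are exactly the interferers. In polar
coordinates `∫_{|y| > R} (1 - 1 / (1 + x (R / |y|) ^ α)) dy = π R² ρ(x)`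
(`lintegral_one_sub_negExp_pathLoss`).

This determines the conditional probability of `t ≤ C` for almost every `R`, for each `t > 0`
separately. Left-continuity in `t` of both sides of the claim extends it from the rational `t` to
all of them. -/

/-! ### The exponential on `[0, ∞]` and the Poisson distribution -/

/-- The decreasing exponential `x ↦ e⁻ˣ` on `[0, ∞]`, with `e^(-∞) = 0`. -/
noncomputable def negExp (x : ℝ≥0∞) : ℝ≥0∞ := EReal.exp (-(x : EReal))

lemma continuous_negExp : Continuous negExp :=
  ENNReal.continuous_exp.comp (continuous_neg.comp continuous_coe_ennreal_ereal)

lemma measurable_negExp : Measurable negExp := continuous_negExp.measurable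

lemma antitone_negExp : Antitone negExp := fun x y h => by
  unfold negExp
  exact EReal.exp_monotone (EReal.neg_le_neg_iff.2 (by exact_mod_cast h))

@[simp] lemma negExp_zero : negExp 0 = 1 := by simp [negExp]

@[simp] lemma negExp_top : negExp ∞ = 0 := by simp [negExp]

lemma negExp_le_one (x : ℝ≥0∞) : negExp x ≤ 1 := by
  simpa using antitone_negExp (zero_le (a := x))

lemma negExp_ne_top (x : ℝ≥0∞) : negExp x ≠ ∞ := ne_top_of_le_ne_top (by simp) (negExp_le_one x)

lemma negExp_add (x y : ℝ≥0∞) : negExp (x + y) = negExp x * negExp y := by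
  unfold negExp
  rw [← EReal.exp_add, EReal.coe_ennreal_add, EReal.neg_add (by simp) (by simp)]
  rfl

lemma negExp_ofReal {x : ℝ} (hx : 0 ≤ x) :
    negExp (ENNReal.ofReal x) = ENNReal.ofReal (Real.exp (-x)) := by
  unfold negExp
  rw [EReal.coe_ennreal_ofReal, max_eq_left hx, ← EReal.coe_neg, EReal.exp_coe]

lemma negExp_sum {ι : Type*} (s : Finset ι) (f : ι → ℝ≥0∞) :
    negExp (∑ i ∈ s, f i) = ∏ i ∈ s, negExp (f i) := by
  classical
  induction s using Finset.induction_on with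
  | empty => simp
  | insert a s ha ih => rw [Finset.sum_insert ha, Finset.prod_insert ha, negExp_add, ih]

lemma negExp_nsmul (n : ℕ) (x : ℝ≥0∞) : negExp (n * x) = negExp x ^ n := by
  simpa using negExp_sum (Finset.range n) (fun _ => x)

/-- The Laplace transform of the Poisson distribution. -/
lemma lintegral_negExp_poissonMeasure (a : ℝ≥0) (c : ℝ≥0∞) :
    ∫⁻ n, negExp (c * n) ∂((poissonMeasure a).map (Nat.cast : ℕ → ℕ∞)) =
      negExp (a * (1 - negExp c)) := by
  have hm : Measurable (fun n : ℕ∞ => negExp (c * (n : ℝ≥0∞))) := measurable_from_top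
  rw [lintegral_map hm measurable_from_top, lintegral_countable']
  set q := (negExp c).toReal with hq
  have hq0 : 0 ≤ q := ENNReal.toReal_nonneg
  have hqc : negExp c = ENNReal.ofReal q := (ENNReal.ofReal_toReal (negExp_ne_top c)).symm
  have hq1 : q ≤ 1 := by
    rw [hq]; exact ENNReal.toReal_le_of_le_ofReal zero_le_one (by simpa using negExp_le_one c)
  have h1 : ∀ n : ℕ, negExp (c * ((n : ℕ∞) : ℝ≥0∞)) * poissonMeasure a {n}
      = ENNReal.ofReal (Real.exp (-a) * ((a * q) ^ n / n.factorial)) := by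
    intro n
    have : ((n : ℕ∞) : ℝ≥0∞) = n := by simp
    rw [this, mul_comm c, negExp_nsmul, hqc, poissonMeasure_singleton, ← ENNReal.ofReal_pow hq0,
      ← ENNReal.ofReal_mul (by positivity)]
    congr 1
    rw [mul_pow]; ring
  simp_rw [h1]
  have hs : HasSum (fun n : ℕ => Real.exp (-a) * ((a * q) ^ n / n.factorial))
      (Real.exp (-a) * Real.exp (a * q)) := by
    rw [Real.exp_eq_exp_ℝ]
    exact (NormedSpace.expSeries_div_hasSum_exp (a * q : ℝ)).mul_left _
  rw [← ENNReal.ofReal_tsum_of_nonneg (fun n => by positivity) hs.summable, hs.tsum_eq, hqc,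
    ← ENNReal.ofReal_one, ← ENNReal.ofReal_sub _ hq0, ← ENNReal.ofReal_coe_nnreal,
    ← ENNReal.ofReal_mul a.coe_nonneg,
    negExp_ofReal (mul_nonneg a.coe_nonneg (by linarith)), ← Real.exp_add]
  congr 2; ring

/-! ### The Laplace functional of a Poisson process -/

section Laplace

/-- The random counting measure `∑ᵢ δ_{bᵢ}` of a sequence of random points. -/
noncomputable def pointMeasure {Ω : Type*} (b : ℕ → Ω → EuclideanSpace ℝ (Fin 2)) (ω : Ω) :
    Measure (EuclideanSpace ℝ (Fin 2)) :=
  Measure.sum fun i => Measure.dirac (b i ω)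

lemma pointMeasure_apply {Ω : Type*} {b : ℕ → Ω → EuclideanSpace ℝ (Fin 2)}
    {A : Set (EuclideanSpace ℝ (Fin 2))} (hA : MeasurableSet A) (ω : Ω) :
    pointMeasure b ω A = (pointCount b A ω : ℝ≥0∞) := by
  rw [pointMeasure, Measure.sum_apply _ hA, pointCount, ← ENNReal.tsum_set_one,
    ← tsum_subtype {i : ℕ | b i ω ∈ A} (fun _ => (1 : ℝ≥0∞)) |>.symm]
  refine tsum_congr fun i => ?_
  rw [Measure.dirac_apply' _ hA]
  simp [Set.indicator]

lemma lintegral_pointMeasure {Ω : Type*} {b : ℕ → Ω → EuclideanSpace ℝ (Fin 2)}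
    {g : EuclideanSpace ℝ (Fin 2) → ℝ≥0∞} (hg : Measurable g) (ω : Ω) :
    ∫⁻ y, g y ∂(pointMeasure b ω) = ∑' i, g (b i ω) := by
  rw [pointMeasure, lintegral_sum_measure]
  exact tsum_congr fun i => lintegral_dirac' _ hg

variable {Ω : Type*} [MeasurableSpace Ω] {μ : Measure Ω} {lam : ℝ≥0}
  {b : ℕ → Ω → EuclideanSpace ℝ (Fin 2)}

lemma IsHomogeneousPPP.measurable_tsum (hb : IsHomogeneousPPP b lam μ)
    {g : EuclideanSpace ℝ (Fin 2) → ℝ≥0∞} (hg : Measurable g) :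
    Measurable fun ω => ∑' i, g (b i ω) :=
  Measurable.tsum fun i => hg.comp (hb.measurable i)

lemma IsHomogeneousPPP.measurable_coe_pointCount (hb : IsHomogeneousPPP b lam μ)
    {A : Set (EuclideanSpace ℝ (Fin 2))} (hA : MeasurableSet A) :
    Measurable fun ω => (pointCount b A ω : ℝ≥0∞) := by
  have h : ∀ ω, (pointCount b A ω : ℝ≥0∞) = ∑' i, A.indicator (fun _ => 1) (b i ω) := fun ω => by
    rw [← pointMeasure_apply hA, ← lintegral_indicator_one hA]
    exact lintegral_pointMeasure (measurable_const.indicator hA) ω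
  simp_rw [h]
  exact hb.measurable_tsum (measurable_const.indicator hA)

lemma IsHomogeneousPPP.lintegral_negExp_count (hb : IsHomogeneousPPP b lam μ)
    {A : Set (EuclideanSpace ℝ (Fin 2))} (hA : MeasurableSet A) (hfin : volume A ≠ ∞) (c : ℝ≥0∞) :
    ∫⁻ ω, negExp (c * pointCount b A ω) ∂μ = negExp (lam * ((1 - negExp c) * volume A)) := by
  have h := hb.hasLaw_count A hA hfin
  have hm : Measurable (fun n : ℕ∞ => negExp (c * (n : ℝ≥0∞))) := measurable_from_top
  rw [← lintegral_map' hm.aemeasurable h.aemeasurable (f := fun n : ℕ∞ => negExp (c * n)),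
    h.map_eq, lintegral_negExp_poissonMeasure]
  congr 1
  push_cast
  rw [ENNReal.coe_toNNReal hfin]; ring

/-- Laplace functional of a Poisson process at a simple function with finite-volume support. The
level sets of the function are disjoint, so the counts in them are independent. -/
lemma IsHomogeneousPPP.laplace_simpleFunc (hb : IsHomogeneousPPP b lam μ)
    (g : SimpleFunc (EuclideanSpace ℝ (Fin 2)) ℝ≥0∞)
    (hfin : ∀ c, c ≠ 0 → volume (g ⁻¹' {c}) ≠ ∞) :
    ∫⁻ ω, negExp (∑' i, g (b i ω)) ∂μ = negExp (lam * ∫⁻ y, (1 - negExp (g y))) := by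
  classical
  set F := g.range.filter (fun c => c ≠ 0) with hF
  let e := F.equivFin.symm
  have hmeas : ∀ c, MeasurableSet (g ⁻¹' {c}) := fun c => g.measurableSet_fiber c
  have hsum : ∀ (ν : Measure (EuclideanSpace ℝ (Fin 2))) (f : ℝ≥0∞ → ℝ≥0∞), f 0 = 0 →
      ∫⁻ y, f (g y) ∂ν = ∑ j, f (e j) * ν (g ⁻¹' {(e j : ℝ≥0∞)}) := by
    intro ν f hf
    have h1 : ∫⁻ y, f (g y) ∂ν = ∑ c ∈ g.range, f c * ν (g ⁻¹' {c}) := by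
      rw [← SimpleFunc.map_lintegral]
      exact SimpleFunc.lintegral_eq_lintegral (g.map f) ν
    rw [h1, e.sum_comp (fun c : F => f c * ν (g ⁻¹' {(c : ℝ≥0∞)})),
      Finset.sum_coe_sort F (fun c => f c * ν (g ⁻¹' {c})), hF]
    refine (Finset.sum_filter_of_ne fun c _ h => ?_).symm
    rintro rfl
    simp [hf] at h
  have hind := hb.indep_count F.card (fun j => g ⁻¹' {(e j : ℝ≥0∞)}) (fun j => hmeas _)
    (fun j k hjk => by
      refine Disjoint.preimage _ (Set.disjoint_singleton.2 fun h => hjk ?_)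
      exact e.injective (Subtype.ext h))
  have hne : ∀ j, (e j : ℝ≥0∞) ≠ 0 := fun j => (Finset.mem_filter.1 (e j).2).2
  have hnum : ∀ ω, ∑' i, g (b i ω) = ∑ j, (e j : ℝ≥0∞) * pointCount b (g ⁻¹' {(e j : ℝ≥0∞)}) ω := by
    intro ω
    rw [← lintegral_pointMeasure g.measurable, hsum _ (fun c => c) rfl]
    exact Finset.sum_congr rfl fun j _ => by rw [pointMeasure_apply (hmeas _)]
  have hm : ∀ c : ℝ≥0∞, Measurable (fun n : ℕ∞ => negExp (c * (n : ℝ≥0∞))) :=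
    fun c => measurable_from_top
  have hind' := hind.comp (fun j (n : ℕ∞) => negExp ((e j : ℝ≥0∞) * n)) (fun j => hm _)
  simp_rw [hnum, negExp_sum]
  have := lintegral_prod_eq_prod_lintegral_of_indepFun (μ := μ) Finset.univ _ hind'
    (fun j => measurable_negExp.comp ((hb.measurable_coe_pointCount (hmeas _)).const_mul _))
  simp only [Function.comp_def] at this
  rw [this, hsum _ (fun c => 1 - negExp c) (by simp), Finset.mul_sum, negExp_sum]
  exact Finset.prod_congr rfl fun j _ => hb.lintegral_negExp_count (hmeas _) (hfin _ (hne j)) _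

lemma tendsto_negExp_tsum {g : EuclideanSpace ℝ (Fin 2) → ℝ≥0∞}
    {G : ℕ → EuclideanSpace ℝ (Fin 2) → ℝ≥0∞} (hG : ∀ n, Measurable (G n)) (hg : Measurable g)
    (hmono : ∀ y, Monotone fun n => G n y)
    (hlim : ∀ y, Filter.Tendsto (fun n => G n y) Filter.atTop (nhds (g y)))
    (β : ℕ → EuclideanSpace ℝ (Fin 2)) :
    Filter.Tendsto (fun n => negExp (∑' i, G n (β i))) Filter.atTop
      (nhds (negExp (∑' i, g (β i)))) := by
  refine (continuous_negExp.tendsto _).comp ?_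
  simp_rw [← lintegral_pointMeasure (b := fun i (_ : Unit) => β i) (hG _) (),
    ← lintegral_pointMeasure (b := fun i (_ : Unit) => β i) hg ()]
  exact lintegral_tendsto_of_tendsto_of_monotone (fun n => (hG n).aemeasurable)
    (ae_of_all _ hmono) (ae_of_all _ hlim)

lemma tendsto_negExp_lintegral {g : EuclideanSpace ℝ (Fin 2) → ℝ≥0∞}
    {G : ℕ → EuclideanSpace ℝ (Fin 2) → ℝ≥0∞} (hG : ∀ n, Measurable (G n))
    (hmono : ∀ y, Monotone fun n => G n y)
    (hlim : ∀ y, Filter.Tendsto (fun n => G n y) Filter.atTop (nhds (g y))) (lam : ℝ≥0) :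
    Filter.Tendsto (fun n => negExp (lam * ∫⁻ y, (1 - negExp (G n y)))) Filter.atTop
      (nhds (negExp (lam * ∫⁻ y, (1 - negExp (g y))))) := by
  refine (continuous_negExp.tendsto _).comp
    (ENNReal.Tendsto.const_mul ?_ (Or.inr ENNReal.coe_ne_top))
  refine lintegral_tendsto_of_tendsto_of_monotone
    (fun n => (measurable_const.sub (measurable_negExp.comp (hG n))).aemeasurable)
    (ae_of_all _ fun y m n hmn => tsub_le_tsub_left (antitone_negExp (hmono y hmn)) _)
    (ae_of_all _ fun y => ?_)
  exact ENNReal.Tendsto.sub tendsto_const_nhds ((continuous_negExp.tendsto _).comp (hlim y))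
    (Or.inl (by simp))

/-- The Laplace functional of a homogeneous Poisson process. -/
theorem IsHomogeneousPPP.laplace [IsProbabilityMeasure μ] (hb : IsHomogeneousPPP b lam μ)
    {g : EuclideanSpace ℝ (Fin 2) → ℝ≥0∞} (hg : Measurable g) :
    ∫⁻ ω, negExp (∑' i, g (b i ω)) ∂μ = negExp (lam * ∫⁻ y, (1 - negExp (g y))) := by
  let G : ℕ → SimpleFunc (EuclideanSpace ℝ (Fin 2)) ℝ≥0∞ := fun n =>
    (SimpleFunc.eapprox g n).restrict (Metric.ball 0 n)
  have hGa : ∀ n y, G n y = (Metric.ball 0 (n : ℝ)).indicator (SimpleFunc.eapprox g n) y :=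
    fun n y => by rw [SimpleFunc.restrict_apply _ measurableSet_ball]
  have hmono : ∀ y, Monotone fun n => G n y := by
    intro y m n hmn
    simp only [hGa]
    refine (Set.indicator_le_indicator (SimpleFunc.monotone_eapprox g hmn y)).trans ?_
    refine Set.indicator_le_indicator_of_subset (Metric.ball_subset_ball (by exact_mod_cast hmn))
      (fun _ => zero_le) y
  have hlim : ∀ y, Filter.Tendsto (fun n => G n y) Filter.atTop (nhds (g y)) := by
    intro y
    refine (SimpleFunc.tendsto_eapprox hg y).congr' ?_
    obtain ⟨N, hN⟩ := exists_nat_gt ‖y‖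
    filter_upwards [Filter.eventually_ge_atTop N] with n hn
    rw [hGa, Set.indicator_of_mem]
    rw [mem_ball_zero_iff]
    exact hN.trans_le (by exact_mod_cast hn)
  have hfin : ∀ n c, c ≠ 0 → volume (G n ⁻¹' {c}) ≠ ∞ := by
    intro n c hc
    refine ne_top_of_le_ne_top (measure_ball_lt_top (x := (0 : EuclideanSpace ℝ (Fin 2)))
      (r := (n : ℝ))).ne (measure_mono fun y hy => ?_)
    by_contra hy'
    rw [Set.mem_preimage, hGa, Set.indicator_of_notMem hy'] at hy
    exact hc hy.symm
  have hL : Filter.Tendsto (fun n => ∫⁻ ω, negExp (∑' i, G n (b i ω)) ∂μ) Filter.atTop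
      (nhds (∫⁻ ω, negExp (∑' i, g (b i ω)) ∂μ)) := by
    refine tendsto_lintegral_of_dominated_convergence (fun _ => 1)
      (fun n => measurable_negExp.comp (hb.measurable_tsum (G n).measurable))
      (fun n => ae_of_all _ fun ω => negExp_le_one _) (by simp) (ae_of_all _ fun ω => ?_)
    exact tendsto_negExp_tsum (fun n => (G n).measurable) hg hmono hlim _
  have hR := tendsto_negExp_lintegral (fun n => (G n).measurable) hmono hlim lam
  refine tendsto_nhds_unique hL (hR.congr fun n => ?_)
  exact (hb.laplace_simpleFunc (G n) (hfin n)).symm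

end Laplace

/-! ### Configurations in general position -/

/-- Configurations of base stations in general position with respect to the user at `z`: finitely
many stations in each bounded region, none at `z`, and no two equidistant from `z`. -/
structure IsGenericConfig (z : EuclideanSpace ℝ (Fin 2)) (β : ℕ → EuclideanSpace ℝ (Fin 2)) :
    Prop where
  finite_le : ∀ r : ℝ, {i | dist z (β i) ≤ r}.Finite
  dist_pos : ∀ i, 0 < dist z (β i)
  dist_injective : Function.Injective fun i => dist z (β i)

section Generic

variable {Ω : Type*} {z : EuclideanSpace ℝ (Fin 2)} {b : ℕ → Ω → EuclideanSpace ℝ (Fin 2)} {ω : Ω}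

lemma IsGenericConfig.servingDist_le (h : IsGenericConfig z fun i => b i ω) (i : ℕ) :
    servingDist z b ω ≤ dist z (b i ω) := by
  have hne : {k : ℕ | ∀ i, dist z (b k ω) ≤ dist z (b i ω)}.Nonempty := by
    obtain ⟨k, hk, hmin⟩ := (h.finite_le (dist z (b 0 ω))).exists_minimalFor
      (fun i => dist z (b i ω)) _ ⟨0, le_refl (dist z (b 0 ω))⟩
    refine ⟨k, fun j => ?_⟩
    by_contra! hlt
    have hj : j ∈ {i | dist z (b i ω) ≤ dist z (b 0 ω)} := hlt.le.trans hk
    exact absurd (hmin hj hlt.le) (not_le.2 hlt)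
  exact Nat.sInf_mem hne i

lemma IsGenericConfig.servingDist_pos (h : IsGenericConfig z fun i => b i ω) :
    0 < servingDist z b ω := h.dist_pos _

lemma IsGenericConfig.servingDist_lt_iff (h : IsGenericConfig z fun i => b i ω) (i : ℕ) :
    servingDist z b ω < dist z (b i ω) ↔ i ≠ servingIndex z b ω := by
  constructor
  · rintro hlt rfl
    exact lt_irrefl _ hlt
  · intro hne
    refine lt_of_le_of_ne (h.servingDist_le i) fun heq => hne ?_
    exact (h.dist_injective heq).symm

lemma IsGenericConfig.le_servingDist_iff (h : IsGenericConfig z fun i => b i ω) (s : ℝ) :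
    s ≤ servingDist z b ω ↔ ∀ i, s ≤ dist z (b i ω) :=
  ⟨fun hs i => hs.trans (h.servingDist_le i), fun hs => hs _⟩

end Generic

section AlmostSure

variable {Ω : Type*} [MeasurableSpace Ω] {μ : Measure Ω} {lam : ℝ≥0}
  {b : ℕ → Ω → EuclideanSpace ℝ (Fin 2)}

lemma IsHomogeneousPPP.measure_pointCount_mem (hb : IsHomogeneousPPP b lam μ)
    {A : Set (EuclideanSpace ℝ (Fin 2))} (hA : MeasurableSet A) (hfin : volume A ≠ ∞)
    (s : Set ℕ∞) :
    μ {ω | pointCount b A ω ∈ s} =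
      poissonMeasure (lam * (volume A).toNNReal) ((Nat.cast : ℕ → ℕ∞) ⁻¹' s) := by
  have h := hb.hasLaw_count A hA hfin
  rw [← Measure.map_apply measurable_from_top (MeasurableSet.of_discrete (s := s)), ← h.map_eq,
    Measure.map_apply_of_aemeasurable h.aemeasurable (MeasurableSet.of_discrete (s := s))]
  rfl

lemma IsHomogeneousPPP.ae_finite (hb : IsHomogeneousPPP b lam μ)
    {A : Set (EuclideanSpace ℝ (Fin 2))} (hA : MeasurableSet A) (hfin : volume A ≠ ∞) :
    ∀ᵐ ω ∂μ, {i | b i ω ∈ A}.Finite := by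
  have h := hb.measure_pointCount_mem hA hfin {⊤}
  have h0 : (Nat.cast : ℕ → ℕ∞) ⁻¹' {⊤} = ∅ := by ext n; simp
  rw [h0, measure_empty] at h
  rw [ae_iff, ← h]
  congr 1
  ext ω
  simp [pointCount, ← Set.not_infinite]

lemma IsHomogeneousPPP.ae_notMem_of_volume_eq_zero (hb : IsHomogeneousPPP b lam μ)
    {A : Set (EuclideanSpace ℝ (Fin 2))} (hA : MeasurableSet A) (h0 : volume A = 0) :
    ∀ᵐ ω ∂μ, ∀ i, b i ω ∉ A := by
  have h := hb.measure_pointCount_mem hA (by simp [h0]) {0}ᶜ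
  have h1 : poissonMeasure 0 ((Nat.cast : ℕ → ℕ∞) ⁻¹' {0}ᶜ) = 0 := by
    have : (Nat.cast : ℕ → ℕ∞) ⁻¹' {0}ᶜ = {0}ᶜ := by ext n; simp
    rw [this, prob_compl_eq_zero_iff (MeasurableSet.singleton 0), poissonMeasure_singleton]
    simp
  rw [h0, ENNReal.toNNReal_zero, mul_zero, h1] at h
  rw [ae_iff, ← h]
  congr 1
  ext ω
  simp [pointCount, Set.eq_empty_iff_forall_notMem]

lemma IsHomogeneousPPP.measure_two_le_pointCount (hb : IsHomogeneousPPP b lam μ)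
    {A : Set (EuclideanSpace ℝ (Fin 2))} (hA : MeasurableSet A) (hfin : volume A ≠ ∞) :
    μ {ω | 2 ≤ pointCount b A ω} ≤ (lam * volume A) ^ 2 := by
  have h := hb.measure_pointCount_mem hA hfin (Set.Ici 2)
  refine (le_of_eq h).trans ?_
  set a := lam * (volume A).toNNReal with ha
  have ha' : lam * volume A = ENNReal.ofReal (a : ℝ) := by
    rw [ENNReal.ofReal_coe_nnreal, ha, ENNReal.coe_mul, ENNReal.coe_toNNReal hfin]
  have h1 : (Nat.cast : ℕ → ℕ∞) ⁻¹' (Set.Ici 2) = ((({0, 1} : Finset ℕ) : Set ℕ))ᶜ := by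
    ext n
    have : (2 : ℕ∞) ≤ n ↔ 2 ≤ n := by exact_mod_cast Nat.cast_le (α := ℕ∞) (m := 2) (n := n)
    simp only [Set.mem_preimage, Set.mem_Ici, this, Finset.coe_insert, Finset.coe_singleton,
      Set.mem_compl_iff, Set.mem_insert_iff, Set.mem_singleton_iff]
    omega
  rw [h1, prob_compl_eq_one_sub (Finset.measurableSet _), ha', ← sum_measure_singleton,
    Finset.sum_pair (by norm_num), poissonMeasure_singleton, poissonMeasure_singleton,
    ← ENNReal.ofReal_add (by positivity) (by positivity), ← ENNReal.ofReal_one,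
    ← ENNReal.ofReal_sub _ (by positivity), ← ENNReal.ofReal_pow a.coe_nonneg]
  refine ENNReal.ofReal_le_ofReal ?_
  have h2 := Real.add_one_le_exp (-(a : ℝ))
  have h3 : (0 : ℝ) ≤ a := a.2
  simp only [pow_zero, pow_one, Nat.factorial_zero, Nat.factorial_one, Nat.cast_one]
  nlinarith [mul_le_mul_of_nonneg_left h2 (by linarith : (0 : ℝ) ≤ 1 + a)]

/-- Almost surely no two points of a Poisson process are equidistant from `z`: a disc can be cut
into `K` annuli of equal area, and the probability that one of them holds two points is `O(1/K)`. -/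
lemma IsHomogeneousPPP.ae_dist_injective (hb : IsHomogeneousPPP b lam μ)
    (z : EuclideanSpace ℝ (Fin 2)) :
    ∀ᵐ ω ∂μ, Function.Injective fun i => dist z (b i ω) := by
  have key : ∀ M : ℕ, 0 < M → μ {ω | ∃ i j, i ≠ j ∧ dist z (b i ω) = dist z (b j ω) ∧
      dist z (b i ω) < M} = 0 := by
    intro M hM
    set T := {ω | ∃ i j, i ≠ j ∧ dist z (b i ω) = dist z (b j ω) ∧ dist z (b i ω) < M}
    have hM' : (0 : ℝ) < M := by exact_mod_cast hM
    have hbound : ∀ K : ℕ, 0 < K → μ T ≤ ENNReal.ofReal ((lam * (Real.pi * M ^ 2)) ^ 2 / K) := by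
      intro K hK
      have hK' : (0 : ℝ) < K := by exact_mod_cast hK
      let ρ : ℕ → ℝ := fun j => Real.sqrt (M ^ 2 * j / K)
      let A : ℕ → Set (EuclideanSpace ℝ (Fin 2)) := fun j =>
        Metric.ball z (ρ (j + 1)) \ Metric.ball z (ρ j)
      have hρ : ∀ j, ρ j ≤ ρ (j + 1) := fun j => by
        refine Real.sqrt_le_sqrt ?_
        push_cast
        gcongr
        linarith
      have hA : ∀ j, MeasurableSet (A j) := fun j => measurableSet_ball.diff measurableSet_ball
      have hvball : ∀ j, volume (Metric.ball z (ρ j)) =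
          ENNReal.ofReal (Real.pi * (M ^ 2 * j / K)) := by
        intro j
        rw [EuclideanSpace.volume_ball_fin_two, ← ENNReal.ofReal_pow (Real.sqrt_nonneg _),
          Real.sq_sqrt (by positivity), ← ENNReal.ofReal_mul (by positivity), mul_comm]
      have hvol : ∀ j, volume (A j) = ENNReal.ofReal (Real.pi * M ^ 2 / K) := by
        intro j
        rw [measure_sdiff (Metric.ball_subset_ball (hρ j)) measurableSet_ball.nullMeasurableSet
          measure_ball_lt_top.ne, hvball, hvball, ← ENNReal.ofReal_sub _ (by positivity)]
        congr 1
        push_cast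
        field_simp
        ring
      have hsub : T ⊆ ⋃ j ∈ Finset.range K, {ω | 2 ≤ pointCount b (A j) ω} := by
        rintro ω ⟨i, j, hij, heq, hlt⟩
        set d := dist z (b i ω) with hd
        have hd0 : 0 ≤ d := dist_nonneg
        set m := ⌊d ^ 2 * K / M ^ 2⌋₊ with hm
        have h0 : 0 ≤ d ^ 2 * K / M ^ 2 := by positivity
        have hmem : ∀ y, dist z y = d → y ∈ A m := by
          intro y hy
          have h1 := Nat.floor_le h0
          have h2 := Nat.lt_floor_add_one (d ^ 2 * K / M ^ 2)
          rw [← hm] at h1 h2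
          constructor
          · rw [Metric.mem_ball', hy]
            refine Real.lt_sqrt_of_sq_lt ?_
            rw [div_lt_iff₀ (by positivity)] at h2
            rw [lt_div_iff₀ hK']
            push_cast
            linarith
          · rw [Metric.mem_ball', hy, not_lt]
            refine Real.sqrt_le_iff.2 ⟨hd0, ?_⟩
            rw [le_div_iff₀ (by positivity)] at h1
            rw [div_le_iff₀ hK']
            linarith
        have hmK : m < K := by
          rw [hm, Nat.floor_lt h0, div_lt_iff₀ (by positivity), mul_comm]
          gcongr
        simp only [Set.mem_iUnion, Finset.mem_range]
        refine ⟨m, hmK, ?_⟩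
        have h2 : ({i, j} : Set ℕ).encard = 2 := Set.encard_pair hij
        change 2 ≤ Set.encard _
        rw [← h2]
        refine Set.encard_le_encard ?_
        rintro l (rfl | rfl)
        · exact hmem _ rfl
        · exact hmem _ heq.symm
      calc μ T ≤ ∑ j ∈ Finset.range K, μ {ω | 2 ≤ pointCount b (A j) ω} :=
            (measure_mono hsub).trans (measure_biUnion_finset_le _ _)
        _ ≤ ∑ j ∈ Finset.range K, (lam * ENNReal.ofReal (Real.pi * M ^ 2 / K)) ^ 2 := by
            refine Finset.sum_le_sum fun j _ => ?_
            rw [← hvol j]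
            exact hb.measure_two_le_pointCount (hA j) (by rw [hvol]; exact ENNReal.ofReal_ne_top)
        _ = ENNReal.ofReal ((lam * (Real.pi * M ^ 2)) ^ 2 / K) := by
            rw [Finset.sum_const, Finset.card_range, nsmul_eq_mul, ← ENNReal.ofReal_coe_nnreal,
              ← ENNReal.ofReal_mul lam.coe_nonneg, ← ENNReal.ofReal_pow (by positivity),
              ← ENNReal.ofReal_natCast, ← ENNReal.ofReal_mul hK'.le]
            congr 1
            field_simp
    have hlim : Filter.Tendsto (fun K : ℕ => ENNReal.ofReal ((lam * (Real.pi * M ^ 2)) ^ 2 / K))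
        Filter.atTop (nhds 0) := by
      rw [← ENNReal.ofReal_zero]
      exact (ENNReal.continuous_ofReal.tendsto _).comp
        (tendsto_const_nhds.div_atTop tendsto_natCast_atTop_atTop)
    refine le_antisymm (ge_of_tendsto hlim ?_) (zero_le)
    filter_upwards [Filter.eventually_gt_atTop 0] with K hK using hbound K hK
  have hall : ∀ᵐ ω ∂μ, ∀ M : ℕ, 0 < M → ¬ ∃ i j, i ≠ j ∧ dist z (b i ω) = dist z (b j ω) ∧
      dist z (b i ω) < M := by
    rw [ae_all_iff]
    intro M
    by_cases hM : 0 < M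
    · filter_upwards [compl_mem_ae_iff.2 (key M hM)] with ω hω _ using hω
    · exact ae_of_all _ fun ω h => absurd h hM
  filter_upwards [hall] with ω hω i j hij
  by_contra hne
  obtain ⟨M, hM⟩ := exists_nat_gt (dist z (b i ω))
  exact hω M (by exact_mod_cast dist_nonneg.trans_lt hM) ⟨i, j, hne, hij, hM⟩

lemma IsHomogeneousPPP.ae_isGenericConfig (hb : IsHomogeneousPPP b lam μ)
    (z : EuclideanSpace ℝ (Fin 2)) : ∀ᵐ ω ∂μ, IsGenericConfig z fun i => b i ω := by
  have h1 : ∀ᵐ ω ∂μ, ∀ n : ℕ, {i | b i ω ∈ Metric.closedBall z n}.Finite :=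
    ae_all_iff.2 fun n => hb.ae_finite measurableSet_closedBall measure_closedBall_lt_top.ne
  have h2 := hb.ae_notMem_of_volume_eq_zero (MeasurableSet.singleton z) (by simp)
  filter_upwards [h1, h2, hb.ae_dist_injective z] with ω hω1 hω2 hω3
  refine ⟨fun r => ?_, fun i => ?_, hω3⟩
  · obtain ⟨n, hn⟩ := exists_nat_ge r
    refine (hω1 n).subset fun i hi => ?_
    rw [Set.mem_ofPred_eq, Metric.mem_closedBall']
    exact le_trans hi hn
  · exact dist_pos.2 fun h => hω2 i h.symm

lemma measurable_servingIndex (hm : ∀ i, Measurable (b i)) (z : EuclideanSpace ℝ (Fin 2)) :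
    Measurable (servingIndex z b) := by
  have hk : ∀ k, MeasurableSet {ω | ∀ i, dist z (b k ω) ≤ dist z (b i ω)} := fun k => by
    rw [Set.ofPred_forall]
    exact MeasurableSet.iInter fun i => measurableSet_le (measurable_const.dist (hm k))
      (measurable_const.dist (hm i))
  have hlt : ∀ n, MeasurableSet {ω | servingIndex z b ω ≤ n} := by
    intro n
    have : {ω | servingIndex z b ω ≤ n} =
        (⋃ k ∈ Set.Iic n, {ω | ∀ i, dist z (b k ω) ≤ dist z (b i ω)}) ∪
          (⋃ k, {ω | ∀ i, dist z (b k ω) ≤ dist z (b i ω)})ᶜ := by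
      ext ω
      simp only [Set.mem_ofPred_eq, Set.mem_union, Set.mem_iUnion, Set.mem_Iic, Set.mem_compl_iff,
        exists_prop, servingIndex]
      constructor
      · intro h
        by_cases hne : ∃ k, ∀ i, dist z (b k ω) ≤ dist z (b i ω)
        · exact Or.inl ⟨_, h, Nat.sInf_mem (s := {k | ∀ i, dist z (b k ω) ≤ dist z (b i ω)}) hne⟩
        · exact Or.inr hne
      · rintro (⟨k, hkn, hk⟩ | hne)
        · exact (Nat.sInf_le (s := {k | ∀ i, dist z (b k ω) ≤ dist z (b i ω)}) hk).trans hkn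
        · have : {k : ℕ | ∀ i, dist z (b k ω) ≤ dist z (b i ω)} = ∅ :=
            Set.eq_empty_of_forall_notMem fun k hk => hne ⟨k, hk⟩
          simp [this]
    rw [this]
    exact (MeasurableSet.biUnion (Set.to_countable _) fun k _ => hk k).union
      (MeasurableSet.iUnion hk).compl
  exact measurable_of_Iic hlt

lemma measurable_servingIndex_apply {X : Type*} [MeasurableSpace X]
    (hm : ∀ i, Measurable (b i)) (z : EuclideanSpace ℝ (Fin 2)) {f : ℕ → Ω → X}
    (hf : ∀ i, Measurable (f i)) : Measurable fun ω => f (servingIndex z b ω) ω :=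
  (measurable_from_prod_countable_right (f := fun p : ℕ × Ω => f p.1 p.2) hf).comp
    ((measurable_servingIndex hm z).prodMk measurable_id)

lemma measurable_servingDist (hm : ∀ i, Measurable (b i)) (z : EuclideanSpace ℝ (Fin 2)) :
    Measurable (servingDist z b) :=
  measurable_servingIndex_apply hm z (f := fun i ω => dist z (b i ω))
    fun i => measurable_const.dist (hm i)

lemma measurable_rxPower (hm : ∀ i, Measurable (b i)) {h : ℕ → Ω → ℝ} (hh : ∀ i, Measurable (h i))
    (P α : ℝ) (z : EuclideanSpace ℝ (Fin 2)) (i : ℕ) : Measurable (rxPower P α z b h i) :=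
  ((hh i).const_mul P).mul ((measurable_const.dist (hm i)).pow_const _)

lemma measurable_linkCapacity (hm : ∀ i, Measurable (b i)) {h : ℕ → Ω → ℝ}
    (hh : ∀ i, Measurable (h i)) (P α σ : ℝ) (z : EuclideanSpace ℝ (Fin 2)) :
    Measurable (linkCapacity P α σ z b h) := by
  have h1 : Measurable (interference P α z b h) := by
    refine Measurable.tsum fun i => Measurable.ite ?_ measurable_const
      (measurable_rxPower hm hh P α z i).ennreal_ofReal
    exact measurable_servingIndex hm z (MeasurableSet.of_discrete (s := {n | i = n}))
  have h2 : Measurable (sinr P α σ z b h) :=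
    (measurable_servingIndex_apply hm z (measurable_rxPower hm hh P α z)).ennreal_ofReal.div
      (measurable_const.add h1)
  exact (Real.measurable_log.comp (measurable_const.add h2.ennreal_toReal)).div_const _

end AlmostSure

/-! ### The point process given the distance to its nearest point -/

section Conditioning

variable {Ω : Type*} [MeasurableSpace Ω] {μ : Measure Ω} [IsProbabilityMeasure μ] {lam : ℝ≥0}
  {b : ℕ → Ω → EuclideanSpace ℝ (Fin 2)}

/-- The Laplace functional of a Poisson process outside a disc, on the event that the disc is
empty. It follows from the Laplace functional at the function that is `∞` on the disc. -/
lemma IsHomogeneousPPP.laplace_le_servingDist (hb : IsHomogeneousPPP b lam μ)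
    (z : EuclideanSpace ℝ (Fin 2)) {g : EuclideanSpace ℝ (Fin 2) → ℝ≥0∞} (hg : Measurable g)
    {s : ℝ} (hgs : ∀ y, dist z y < s → g y = 0) :
    ∫⁻ ω in {ω | s ≤ servingDist z b ω}, negExp (∑' i, g (b i ω)) ∂μ =
      negExp (lam * volume (Metric.ball z s)) * negExp (lam * ∫⁻ y, (1 - negExp (g y))) := by
  classical
  have hind : Measurable ((Metric.ball z s).indicator (fun _ => (∞ : ℝ≥0∞))) :=
    measurable_const.indicator measurableSet_ball
  have hmeas : MeasurableSet {ω | s ≤ servingDist z b ω} :=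
    measurableSet_le measurable_const (measurable_servingDist hb.measurable z)
  have h := hb.laplace (hg.add hind)
  have hL : ∫⁻ ω, negExp (∑' i, (g + (Metric.ball z s).indicator (fun _ => ∞)) (b i ω)) ∂μ =
      ∫⁻ ω in {ω | s ≤ servingDist z b ω}, negExp (∑' i, g (b i ω)) ∂μ := by
    rw [← lintegral_indicator hmeas]
    refine lintegral_congr_ae ?_
    filter_upwards [hb.ae_isGenericConfig z] with ω hω
    simp only [Pi.add_apply, ENNReal.tsum_add, negExp_add]
    by_cases hs : s ≤ servingDist z b ω
    · rw [Set.indicator_of_mem (show ω ∈ {ω | s ≤ servingDist z b ω} from hs)]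
      have : ∀ i, (Metric.ball z s).indicator (fun _ => (∞ : ℝ≥0∞)) (b i ω) = 0 := fun i => by
        rw [Set.indicator_of_notMem]
        rw [Metric.mem_ball', not_lt]
        exact (hω.le_servingDist_iff s).1 hs i
      simp [this]
    · rw [Set.indicator_of_notMem (show ω ∉ {ω | s ≤ servingDist z b ω} from hs)]
      have : ∑' i, (Metric.ball z s).indicator (fun _ => (∞ : ℝ≥0∞)) (b i ω) = ∞ := by
        refine ENNReal.tsum_eq_top_of_eq_top ⟨servingIndex z b ω, ?_⟩
        rw [Set.indicator_of_mem]
        rw [Metric.mem_ball']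
        exact not_le.1 hs
      simp [this]
  have hR : ∀ y, 1 - negExp ((g + (Metric.ball z s).indicator (fun _ => ∞)) y) =
      (Metric.ball z s).indicator (fun _ => 1) y + (1 - negExp (g y)) := by
    intro y
    by_cases hy : y ∈ Metric.ball z s
    · simp [hy, hgs y (Metric.mem_ball'.1 hy)]
    · simp [hy]
  rw [← hL, h]
  simp_rw [hR]
  rw [lintegral_add_left (measurable_const.indicator measurableSet_ball), mul_add, negExp_add,
    lintegral_indicator_const measurableSet_ball, one_mul]

/-- The distance to the nearest point, capped at `r`, is independent of the points at distance at
least `r`: the events `{s ≤ min R r}` generate, and for `s ≤ r` they say that a disc is empty. -/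
lemma IsHomogeneousPPP.lintegral_min_servingDist (hb : IsHomogeneousPPP b lam μ)
    (z : EuclideanSpace ℝ (Fin 2)) {g : EuclideanSpace ℝ (Fin 2) → ℝ≥0∞} (hg : Measurable g)
    {r : ℝ} (hgr : ∀ y, dist z y < r → g y = 0) {w : ℝ → ℝ≥0∞} (hw : Measurable w) :
    ∫⁻ ω, w (min (servingDist z b ω) r) * negExp (∑' i, g (b i ω)) ∂μ =
      ∫⁻ ω, w (min (servingDist z b ω) r) * negExp (lam * ∫⁻ y, (1 - negExp (g y))) ∂μ := by
  set X : Ω → ℝ := fun ω => min (servingDist z b ω) r with hX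
  set Y : Ω → ℝ≥0∞ := fun ω => negExp (∑' i, g (b i ω)) with hY
  set q := negExp (lam * ∫⁻ y, (1 - negExp (g y))) with hq
  have hXm : Measurable X := (measurable_servingDist hb.measurable z).min measurable_const
  have hYm : Measurable Y := measurable_negExp.comp (hb.measurable_tsum hg)
  have hfin : IsFiniteMeasure (μ.withDensity Y) := isFiniteMeasure_withDensity
    (ne_top_of_le_ne_top ENNReal.one_ne_top
      ((lintegral_mono fun ω => negExp_le_one _).trans (by simp)))
  have hlaw : (μ.withDensity Y).map X = q • μ.map X := by
    refine Measure.ext_of_Ici _ _ fun s => ?_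
    rw [Measure.smul_apply, Measure.map_apply hXm measurableSet_Ici,
      Measure.map_apply hXm measurableSet_Ici, withDensity_apply _ (hXm measurableSet_Ici)]
    by_cases hs : s ≤ r
    · have hset : X ⁻¹' Set.Ici s = {ω | s ≤ servingDist z b ω} := by
        ext ω
        simp [hX, hs]
      have h0 := hb.laplace_le_servingDist z (g := fun _ => 0) measurable_const (s := s)
        (fun _ _ => rfl)
      simp only [tsum_zero, negExp_zero, tsub_self, lintegral_zero, mul_zero, mul_one,
        setLIntegral_one] at h0
      rw [hset, h0, hb.laplace_le_servingDist z hg fun y hy => hgr y (hy.trans_le hs), smul_eq_mul,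
        mul_comm]
    · have hset : X ⁻¹' Set.Ici s = ∅ := by
        ext ω
        simp [hX, hs]
      simp [hset]
  have hwX : Measurable fun ω => w (X ω) := hw.comp hXm
  calc ∫⁻ ω, w (X ω) * Y ω ∂μ = ∫⁻ ω, w (X ω) ∂(μ.withDensity Y) := by
        rw [lintegral_withDensity_eq_lintegral_mul _ hYm hwX]
        exact lintegral_congr fun ω => mul_comm _ _
    _ = ∫⁻ u, w u ∂((μ.withDensity Y).map X) := (lintegral_map hw hXm).symm
    _ = ∫⁻ ω, w (X ω) * q ∂μ := by
        rw [hlaw, lintegral_smul_measure, lintegral_map hw hXm, 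
          lintegral_mul_const _ hwX,
          smul_eq_mul, mul_comm]

lemma monotone_dyadic_floor (r : ℝ) : Monotone fun n : ℕ => (⌊r * 2 ^ n⌋₊ : ℝ) / 2 ^ n := by
  refine monotone_nat_of_le_succ fun n => ?_
  rw [pow_succ, div_le_div_iff₀ (by positivity) (by positivity)]
  have h : 2 * ⌊r * 2 ^ n⌋₊ ≤ ⌊r * (2 ^ n * 2)⌋₊ := by
    rcases le_or_gt 0 r with hr | hr
    · refine Nat.le_floor ?_
      push_cast
      linarith [Nat.floor_le (show 0 ≤ r * 2 ^ n by positivity)]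
    · rw [Nat.floor_of_nonpos (mul_nonpos_of_nonpos_of_nonneg hr.le (by positivity))]
      simp
  have h' : (2 * ⌊r * 2 ^ n⌋₊ : ℝ) ≤ ⌊r * (2 ^ n * 2)⌋₊ := by exact_mod_cast h
  nlinarith [show (0 : ℝ) < 2 ^ n by positivity]

lemma antitone_dyadic_floor_add_one (r : ℝ) :
    Antitone fun n : ℕ => ((⌊r * 2 ^ n⌋₊ : ℝ) + 1) / 2 ^ n := by
  refine antitone_nat_of_succ_le fun n => ?_
  rw [pow_succ, div_le_div_iff₀ (by positivity) (by positivity)]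
  have h : ⌊r * (2 ^ n * 2)⌋₊ < 2 * (⌊r * 2 ^ n⌋₊ + 1) := by
    rw [Nat.floor_lt' (by omega)]
    push_cast
    linarith [Nat.lt_floor_add_one (r * 2 ^ n)]
  have h' : (⌊r * (2 ^ n * 2)⌋₊ + 1 : ℝ) ≤ 2 * (⌊r * 2 ^ n⌋₊ + 1) := by exact_mod_cast h
  nlinarith [show (0 : ℝ) < 2 ^ n by positivity]

lemma tendsto_dyadic_floor {r : ℝ} (hr : 0 ≤ r) :
    Filter.Tendsto (fun n : ℕ => (⌊r * 2 ^ n⌋₊ : ℝ) / 2 ^ n) Filter.atTop (nhds r) :=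
  (tendsto_nat_floor_mul_div_atTop hr).comp (tendsto_pow_atTop_atTop_of_one_lt one_lt_two)

lemma tendsto_dyadic_floor_add_one {r : ℝ} (hr : 0 ≤ r) :
    Filter.Tendsto (fun n : ℕ => ((⌊r * 2 ^ n⌋₊ : ℝ) + 1) / 2 ^ n) Filter.atTop (nhds r) := by
  have h2 : Filter.Tendsto (fun n : ℕ => (1 : ℝ) / 2 ^ n) Filter.atTop (nhds 0) :=
    tendsto_const_nhds.div_atTop (tendsto_pow_atTop_atTop_of_one_lt one_lt_two)
  simpa [add_div] using (tendsto_dyadic_floor hr).add h2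

lemma lt_dyadic_floor_add_one (r : ℝ) (n : ℕ) : r < ((⌊r * 2 ^ n⌋₊ : ℝ) + 1) / 2 ^ n := by
  rw [lt_div_iff₀ (by positivity)]
  exact Nat.lt_floor_add_one _

/-- Given the distance `R` to the nearest point, the points farther than `R` form a Poisson process
on the complement of the disc of radius `R`. The weight `K R` put on them
may depend on `R`: replacing `R` by its dyadic approximations `⌊R 2ⁿ⌋ / 2ⁿ` in `K` and
`(⌊R 2ⁿ⌋ + 1) / 2ⁿ` in the cut-off gives weights that increase to the right one and are constant on
each dyadic cell, where the independence of the nearest distance and the farther points applies. -/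
theorem IsHomogeneousPPP.laplace_given_servingDist (hb : IsHomogeneousPPP b lam μ)
    (z : EuclideanSpace ℝ (Fin 2)) {K : ℝ → EuclideanSpace ℝ (Fin 2) → ℝ≥0∞}
    (hK : Measurable (Function.uncurry K)) (hmono : ∀ y, MonotoneOn (fun r => K r y) (Set.Ici 0))
    (hcont : ∀ y r, 0 < r → ContinuousAt (fun r => K r y) r)
    {w : ℝ → ℝ≥0∞} (hw : Measurable w) (hw1 : ∀ r, w r ≤ 1) :
    ∫⁻ ω, w (servingDist z b ω) * negExp (∑' i, if servingDist z b ω < dist z (b i ω) then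
        K (servingDist z b ω) (b i ω) else 0) ∂μ =
      ∫⁻ ω, w (servingDist z b ω) * negExp (lam * ∫⁻ y, (1 - negExp
        (if servingDist z b ω < dist z y then K (servingDist z b ω) y else 0))) ∂μ := by
  have hRm := measurable_servingDist hb.measurable z
  have hKr : ∀ r, Measurable (K r) := fun r => hK.comp (measurable_const.prodMk measurable_id)
  -- `g n m` is the value on the dyadic cell `[m / 2ⁿ, (m + 1) / 2ⁿ)` of the approximation
  obtain ⟨g, hg⟩ : ∃ g : ℕ → ℕ → EuclideanSpace ℝ (Fin 2) → ℝ≥0∞, ∀ n m y, g n m y =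
    if ((m : ℝ) + 1) / 2 ^ n ≤ dist z y then K ((m : ℝ) / 2 ^ n) y else 0 :=
      ⟨_, fun _ _ _ => rfl⟩
  have hgm : ∀ n m, Measurable (g n m) := fun n m => by
    rw [funext (hg n m)]
    exact Measurable.ite (measurableSet_le measurable_const (measurable_const.dist measurable_id))
      (hKr _) measurable_const
  obtain ⟨N, hN⟩ : ∃ N : ℕ → ℝ → ℕ, ∀ n r, N n r = ⌊r * 2 ^ n⌋₊ := ⟨_, fun _ _ => rfl⟩
  have hNm : ∀ n, Measurable (N n) := fun n => by
    rw [funext (hN n)]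
    exact Nat.measurable_floor.comp (measurable_id.mul_const _)
  have hgmono : ∀ r, ∀ y, Monotone fun n => g n (N n r) y := by
    intro r y n n' hn
    simp only [hg, hN]
    have h1 := antitone_dyadic_floor_add_one r hn
    have h2 := monotone_dyadic_floor r hn
    split_ifs with h3 h4
    · exact hmono y (Set.mem_Ici.2 (by positivity)) (Set.mem_Ici.2 (by positivity)) h2
    · exact absurd (h1.trans h3) h4
    · exact zero_le
    · exact le_rfl
  have hglim : ∀ r, 0 < r → ∀ y, Filter.Tendsto (fun n => g n (N n r) y) Filter.atTop
      (nhds (if r < dist z y then K r y else 0)) := by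
    intro r hr y
    split_ifs with hy
    · have h1 := (hcont y r hr).tendsto.comp (tendsto_dyadic_floor hr.le)
      refine h1.congr' ?_
      filter_upwards [(tendsto_dyadic_floor_add_one hr.le).eventually_le_const hy] with n hn
      rw [hg, hN, if_pos hn]
      rfl
    · refine tendsto_const_nhds.congr fun n => ?_
      rw [hg, hN, if_neg]
      exact not_le.2 ((not_lt.1 hy).trans_lt (lt_dyadic_floor_add_one r n))
  have hae : ∀ᵐ ω ∂μ, 0 < servingDist z b ω := by
    filter_upwards [hb.ae_isGenericConfig z] with ω hω using hω.servingDist_pos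
  have hgN : ∀ n, Measurable fun p : ℝ × EuclideanSpace ℝ (Fin 2) => g n (N n p.1) p.2 := by
    intro n
    have h1 : Measurable fun p : ℝ × EuclideanSpace ℝ (Fin 2) => (N n p.1 : ℝ) :=
      measurable_from_top.comp ((hNm n).comp measurable_fst)
    simp_rw [hg]
    exact Measurable.ite (measurableSet_le ((h1.add_const _).div_const _)
      (measurable_const.dist measurable_snd))
      (hK.comp ((h1.div_const _).prodMk measurable_snd)) measurable_const
  have hwR : Measurable fun ω => w (servingDist z b ω) := hw.comp hRm
  have hLm : ∀ n, Measurable fun ω => w (servingDist z b ω) *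
      negExp (∑' i, g n (N n (servingDist z b ω)) (b i ω)) := by
    intro n
    have h1 : ∀ i, Measurable fun ω => g n (N n (servingDist z b ω)) (b i ω) := fun i =>
      (hgN n).comp (hRm.prodMk (hb.measurable i))
    exact hwR.mul (measurable_negExp.comp (Measurable.tsum h1))
  have hRm' : ∀ n, Measurable fun ω => w (servingDist z b ω) * negExp (lam * ∫⁻ y, (1 - negExp
      (g n (N n (servingDist z b ω)) y))) := by
    intro n
    have h1 : Measurable fun p : ℝ × EuclideanSpace ℝ (Fin 2) => 1 - negExp (g n (N n p.1) p.2) :=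
      measurable_const.sub (measurable_negExp.comp (hgN n))
    have h2 : Measurable fun r : ℝ => ∫⁻ y, (1 - negExp (g n (N n r) y)) :=
      h1.lintegral_prod_right'
    have h3 : Measurable fun ω => lam * ∫⁻ y, (1 - negExp (g n (N n (servingDist z b ω)) y)) :=
      (h2.comp hRm).const_mul _
    exact hwR.mul (measurable_negExp.comp h3)
  have hbound : ∀ (r : ℝ) (x : ℝ≥0∞), w r * negExp x ≤ 1 := fun r x =>
    mul_le_one' (hw1 r) (negExp_le_one x)
  have hL : Filter.Tendsto (fun n => ∫⁻ ω, w (servingDist z b ω) *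
      negExp (∑' i, g n (N n (servingDist z b ω)) (b i ω)) ∂μ) Filter.atTop
      (nhds (∫⁻ ω, w (servingDist z b ω) * negExp (∑' i, if servingDist z b ω < dist z (b i ω) then
        K (servingDist z b ω) (b i ω) else 0) ∂μ)) := by
    refine tendsto_lintegral_of_dominated_convergence (fun _ => 1) hLm
      (fun n => ae_of_all _ fun ω => hbound _ _) (by simp) (hae.mono fun ω hω => ?_)
    refine ENNReal.Tendsto.const_mul ?_ (Or.inr (ne_top_of_le_ne_top ENNReal.one_ne_top (hw1 _)))
    exact tendsto_negExp_tsum (G := fun n => g n (N n (servingDist z b ω)))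
      (g := fun y => if servingDist z b ω < dist z y then K (servingDist z b ω) y else 0)
      (fun n => hgm n _)
      (Measurable.ite (measurableSet_lt measurable_const (measurable_const.dist measurable_id))
        (hKr _) measurable_const) (hgmono _) (hglim _ hω) (fun i => b i ω)
  have hR : Filter.Tendsto (fun n => ∫⁻ ω, w (servingDist z b ω) * negExp (lam * ∫⁻ y, (1 - negExp
      (g n (N n (servingDist z b ω)) y))) ∂μ) Filter.atTop
      (nhds (∫⁻ ω, w (servingDist z b ω) * negExp (lam * ∫⁻ y, (1 - negExp
        (if servingDist z b ω < dist z y then K (servingDist z b ω) y else 0))) ∂μ)) := by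
    refine tendsto_lintegral_of_dominated_convergence (fun _ => 1) hRm'
      (fun n => ae_of_all _ fun ω => hbound _ _) (by simp) (hae.mono fun ω hω => ?_)
    refine ENNReal.Tendsto.const_mul ?_ (Or.inr (ne_top_of_le_ne_top ENNReal.one_ne_top (hw1 _)))
    exact tendsto_negExp_lintegral (G := fun n => g n (N n (servingDist z b ω)))
      (fun n => hgm n _) (hgmono _) (hglim _ hω) lam
  refine tendsto_nhds_unique hL (hR.congr fun n => ?_)
  -- Both sides are split according to the dyadic cell of the distance.
  have hcell : ∀ m : ℕ, Measurable fun u : ℝ =>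
      (Set.Ico ((m : ℝ) / 2 ^ n) (((m : ℝ) + 1) / 2 ^ n)).indicator w u :=
    fun m => hw.indicator measurableSet_Ico
  have hsplit : ∀ F : ℕ → Ω → ℝ≥0∞, (∀ m, Measurable (F m)) →
      ∫⁻ ω, w (servingDist z b ω) * F (N n (servingDist z b ω)) ω ∂μ =
        ∑' m : ℕ, ∫⁻ ω, (Set.Ico ((m : ℝ) / 2 ^ n) (((m : ℝ) + 1) / 2 ^ n)).indicator w
          (min (servingDist z b ω) (((m : ℝ) + 1) / 2 ^ n)) * F m ω ∂μ := by
    intro F hF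
    have hterm : ∀ m : ℕ, Measurable fun ω =>
        (Set.Ico ((m : ℝ) / 2 ^ n) (((m : ℝ) + 1) / 2 ^ n)).indicator w
          (min (servingDist z b ω) (((m : ℝ) + 1) / 2 ^ n)) * F m ω := fun m =>
      ((hcell m).comp (hRm.min measurable_const)).mul (hF m)
    rw [← lintegral_tsum fun m => (hterm m).aemeasurable]
    refine lintegral_congr_ae (hae.mono fun ω hω => ?_)
    have hmem : ∀ m : ℕ, min (servingDist z b ω) (((m : ℝ) + 1) / 2 ^ n) ∈
        Set.Ico ((m : ℝ) / 2 ^ n) (((m : ℝ) + 1) / 2 ^ n) ↔ N n (servingDist z b ω) = m := by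
      intro m
      have h2 : (0 : ℝ) < 2 ^ n := by positivity
      have hle : (m : ℝ) / 2 ^ n ≤ ((m : ℝ) + 1) / 2 ^ n := by gcongr; linarith
      rw [Set.mem_Ico, hN, Nat.floor_eq_iff (by positivity)]
      simp only [le_min_iff, min_lt_iff, lt_irrefl, or_false, hle, and_true]
      rw [div_le_iff₀ h2, lt_div_iff₀ h2]
    beta_reduce
    rw [tsum_eq_single (N n (servingDist z b ω))]
    · have h1 := (hmem _).2 rfl
      rw [Set.indicator_of_mem h1, hN, min_eq_left (lt_dyadic_floor_add_one _ n).le]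
    · intro m hm
      rw [Set.indicator_of_notMem (fun h => hm ((hmem m).1 h).symm), zero_mul]
  rw [hsplit (fun m ω => negExp (lam * ∫⁻ y, (1 - negExp (g n m y)))) (fun m => measurable_const),
    hsplit (fun m ω => negExp (∑' i, g n m (b i ω)))
      (fun m => measurable_negExp.comp (hb.measurable_tsum (hgm n m)))]
  refine tsum_congr fun m => ?_
  exact (hb.lintegral_min_servingDist z (hgm n m) (fun y hy => by rw [hg, if_neg (not_le.2 hy)])
    (hcell m)).symm

end Conditioning

/-! ### Exponential fading -/

section Fading

lemma expMeasure_one_eq : expMeasure 1 = volume.withDensity (exponentialPDF 1) := rfl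

/-- Tail of the standard exponential distribution, at a threshold in `[0, ∞]`. -/
lemma expMeasure_one_le_ofReal (c : ℝ≥0∞) :
    expMeasure 1 {x | c ≤ ENNReal.ofReal x} = negExp c := by
  have := isProbabilityMeasure_expMeasure zero_lt_one
  induction c with
  | top => simp
  | coe c =>
    rcases eq_or_ne c 0 with rfl | hc
    · simp
    have h1 : {x : ℝ | (c : ℝ≥0∞) ≤ ENNReal.ofReal x} = Set.Ici (c : ℝ) := by
      ext x
      simp only [Set.mem_ofPred_eq, Set.mem_Ici]
      rw [← ENNReal.ofReal_coe_nnreal, ENNReal.ofReal_le_ofReal_iff']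
      have : (0 : ℝ) < c := by positivity
      constructor
      · rintro (h | h)
        · exact h
        · linarith
      · exact Or.inl
    have h2 : (expMeasure 1) (Set.Iio (c : ℝ)) = (expMeasure 1) (Set.Iic (c : ℝ)) := by
      have hac : expMeasure 1 ≪ volume := by
        rw [expMeasure_one_eq]; exact withDensity_absolutelyContinuous _ _
      exact measure_congr (hac.ae_eq Iio_ae_eq_Iic)
    have h3 := ofReal_cdf (expMeasure 1) (c : ℝ)
    rw [cdf_expMeasure_eq zero_lt_one, if_pos c.coe_nonneg] at h3
    rw [h1, ← Set.compl_Iio, prob_compl_eq_one_sub measurableSet_Iio, h2, ← h3,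
      ← ENNReal.ofReal_coe_nnreal, negExp_ofReal c.coe_nonneg, ← ENNReal.ofReal_one,
      ← ENNReal.ofReal_sub]
    · congr 1
      simp
    · simp

lemma negExp_ofReal_log {u : ℝ} (hu : 1 ≤ u) :
    negExp (ENNReal.ofReal (Real.log u)) = ENNReal.ofReal u⁻¹ := by
  rw [negExp_ofReal (Real.log_nonneg hu), Real.exp_neg, Real.exp_log (by linarith)]

/-- Laplace transform of the standard exponential distribution. -/
lemma lintegral_negExp_expMeasure_one {a : ℝ} (ha : 0 ≤ a) :
    ∫⁻ x, negExp (ENNReal.ofReal (a * x)) ∂(expMeasure 1) =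
      negExp (ENNReal.ofReal (Real.log (1 + a))) := by
  have hm : ∀ r, Measurable (exponentialPDF r) := fun r =>
    (measurable_exponentialPDFReal r).ennreal_ofReal
  have hm2 : Measurable fun x : ℝ => negExp (ENNReal.ofReal (a * x)) :=
    measurable_negExp.comp (measurable_id.const_mul a).ennreal_ofReal
  rw [expMeasure_one_eq, lintegral_withDensity_eq_lintegral_mul _ (hm 1) hm2,
    negExp_ofReal_log (by linarith)]
  have h1 : ∀ x, (exponentialPDF 1 * fun x : ℝ => negExp (ENNReal.ofReal (a * x))) x =
      ENNReal.ofReal (1 + a)⁻¹ * exponentialPDF (1 + a) x := by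
    intro x
    rw [Pi.mul_apply]
    rcases lt_or_ge x 0 with hx | hx
    · rw [exponentialPDF_of_neg hx, exponentialPDF_of_neg hx]; simp
    · rw [exponentialPDF_of_nonneg hx, exponentialPDF_of_nonneg hx,
        negExp_ofReal (mul_nonneg ha hx), ← ENNReal.ofReal_mul (by positivity),
        ← ENNReal.ofReal_mul (by positivity)]
      congr 1
      rw [← mul_assoc, inv_mul_cancel₀ (by linarith), one_mul, one_mul, one_mul, ← Real.exp_add]
      congr 1; ring
  simp_rw [h1]
  rw [lintegral_const_mul _ (hm _), lintegral_exponentialPDF_eq_one (by linarith), mul_one]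

variable {Ω : Type*} [MeasurableSpace Ω] {μ : Measure Ω} [IsProbabilityMeasure μ]
  {b : ℕ → Ω → EuclideanSpace ℝ (Fin 2)} {h : ℕ → Ω → ℝ}

lemma IsRayleighFading.measure_finsetSum_le (hh : IsRayleighFading h b μ) {k : ℕ} {s : Finset ℕ}
    (hk : k ∉ s) (c : ℝ≥0∞) {a : ℕ → ℝ} (ha : ∀ i, 0 ≤ a i) :
    μ {ω | c + ∑ i ∈ s, ENNReal.ofReal (a i * h i ω) ≤ ENNReal.ofReal (h k ω)} =
      negExp (c + ∑ i ∈ s, ENNReal.ofReal (Real.log (1 + a i))) := by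
  have hfm : ∀ i, Measurable fun x : ℝ => ENNReal.ofReal (a i * x) := fun i =>
    (measurable_id.const_mul _).ennreal_ofReal
  set T : Ω → ℝ≥0∞ := fun ω => c + ∑ i ∈ s, ENNReal.ofReal (a i * h i ω) with hT
  have hTm : Measurable T := measurable_const.add
    (Finset.measurable_sum _ fun i _ => (hfm i).comp (hh.measurable i))
  have hind : IndepFun T (h k) μ := by
    have h1 := hh.iIndep.indepFun_finset s {k} (Finset.disjoint_singleton_right.2 hk) hh.measurable
    have hφ : Measurable fun v : s → ℝ => c + ∑ i : s, ENNReal.ofReal (a i * v i) :=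
      measurable_const.add (Finset.measurable_sum _ fun i _ =>
        (hfm i).comp (measurable_pi_apply i))
    have hψ : Measurable fun v : ({k} : Finset ℕ) → ℝ => v ⟨k, Finset.mem_singleton_self k⟩ :=
      measurable_pi_apply _
    have h2 := h1.comp hφ hψ
    have h3 : T = (fun v : s → ℝ => c + ∑ i : s, ENNReal.ofReal (a i * v i)) ∘
        fun ω (i : s) => h i ω := by
      funext ω
      simp only [hT, Function.comp_apply]
      rw [← Finset.sum_coe_sort s]
    rw [h3]
    exact h2
  have hset : MeasurableSet {p : ℝ≥0∞ × ℝ | p.1 ≤ ENNReal.ofReal p.2} :=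
    measurableSet_le measurable_fst measurable_snd.ennreal_ofReal
  have hprod := (indepFun_iff_map_prod_eq_prod_map_map hTm.aemeasurable
    (hh.measurable k).aemeasurable).1 hind
  calc μ {ω | T ω ≤ ENNReal.ofReal (h k ω)}
      = (μ.map fun ω => (T ω, h k ω)) {p | p.1 ≤ ENNReal.ofReal p.2} := by
        rw [Measure.map_apply (hTm.prodMk (hh.measurable k)) hset]; rfl
    _ = ∫⁻ t, negExp t ∂(μ.map T) := by
        rw [hprod, Measure.prod_apply hset, (hh.hasLaw k).map_eq]
        exact lintegral_congr fun t => expMeasure_one_le_ofReal t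
    _ = ∫⁻ ω, negExp c * ∏ i ∈ s, negExp (ENNReal.ofReal (a i * h i ω)) ∂μ := by
        rw [lintegral_map measurable_negExp hTm]
        exact lintegral_congr fun ω => by rw [hT, negExp_add, negExp_sum]
    _ = negExp (c + ∑ i ∈ s, ENNReal.ofReal (Real.log (1 + a i))) := by
        have hYm : ∀ i, Measurable fun x : ℝ => negExp (ENNReal.ofReal (a i * x)) := fun i =>
          measurable_negExp.comp (hfm i)
        have h1 := lintegral_prod_eq_prod_lintegral_of_indepFun s _ (hh.iIndep.comp _ hYm)
          (fun i => (hYm i).comp (hh.measurable i))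
        simp only [Function.comp_def] at h1
        have h2 : Measurable fun ω => ∏ i ∈ s, negExp (ENNReal.ofReal (a i * h i ω)) :=
          Finset.measurable_prod _ fun i _ => (hYm i).comp (hh.measurable i)
        rw [lintegral_const_mul _ h2, h1, negExp_add, negExp_sum]
        congr 1
        refine Finset.prod_congr rfl fun i _ => ?_
        rw [← lintegral_negExp_expMeasure_one (ha i), ← (hh.hasLaw i).map_eq,
          lintegral_map (hYm i) (hh.measurable i)]

/-- With Rayleigh fading, the probability that the `k`-th link withstands a fixed noise `c` together
with the interference of all the other links, received with gains `a i`. -/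
lemma IsRayleighFading.measure_tsum_le (hh : IsRayleighFading h b μ) (k : ℕ) (c : ℝ≥0∞)
    {a : ℕ → ℝ} (ha : ∀ i, 0 ≤ a i) :
    μ {ω | c + (∑' i, if i = k then 0 else ENNReal.ofReal (a i * h i ω)) ≤
        ENNReal.ofReal (h k ω)} =
      negExp (c + ∑' i, if i = k then 0 else ENNReal.ofReal (Real.log (1 + a i))) := by
  have hsum : ∀ (f : ℕ → ℝ≥0∞) (n : ℕ), ∑ i ∈ Finset.range n, (if i = k then 0 else f i) =
      ∑ i ∈ (Finset.range n).filter (fun i => i ≠ k), f i := fun f n => by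
    rw [Finset.sum_filter]
    exact Finset.sum_congr rfl fun i _ => by by_cases hi : i = k <;> simp [hi]
  set A : ℕ → Set Ω := fun n => {ω | c + ∑ i ∈ Finset.range n,
    (if i = k then 0 else ENNReal.ofReal (a i * h i ω)) ≤ ENNReal.ofReal (h k ω)} with hA
  have hAm : ∀ n, MeasurableSet (A n) := fun n => by
    refine measurableSet_le (measurable_const.add (Finset.measurable_sum _ fun i _ => ?_))
      (hh.measurable k).ennreal_ofReal
    split_ifs
    · exact measurable_const
    · exact ((hh.measurable i).const_mul _).ennreal_ofReal
  have hAanti : Antitone A := fun m n hmn ω hω => by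
    have hω' : c + ∑ i ∈ Finset.range n, (if i = k then 0 else ENNReal.ofReal (a i * h i ω)) ≤
      ENNReal.ofReal (h k ω) := hω
    refine le_trans ?_ hω'
    gcongr
  have hInter : {ω | c + (∑' i, if i = k then 0 else ENNReal.ofReal (a i * h i ω)) ≤
        ENNReal.ofReal (h k ω)} = ⋂ n, A n := by
    ext ω
    simp only [hA, Set.mem_ofPred_eq, Set.mem_iInter]
    rw [ENNReal.tsum_eq_iSup_nat, ENNReal.add_iSup, iSup_le_iff]
  rw [hInter]
  have h1 := tendsto_measure_iInter_atTop (μ := μ) (fun n => (hAm n).nullMeasurableSet) hAanti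
    ⟨0, measure_ne_top _ _⟩
  refine tendsto_nhds_unique h1 ?_
  have h2 : ∀ n, μ (A n) = negExp (c + ∑ i ∈ Finset.range n,
      (if i = k then 0 else ENNReal.ofReal (Real.log (1 + a i)))) := fun n => by
    simp only [hA, hsum]
    exact hh.measure_finsetSum_le (by simp) c ha
  simp only [Function.comp_def, h2]
  exact (continuous_negExp.tendsto _).comp
    ((ENNReal.tendsto_nat_tsum _).const_add c)

end Fading

/-! ### The integral over the plane -/

section Radial

variable {α : ℝ}

lemma integrableOn_one_div_one_add_rpow (hα : 2 < α) {a : ℝ} (ha : 0 < a) :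
    IntegrableOn (fun u : ℝ => 1 / (1 + u ^ (α / 2))) (Set.Ioi a) := by
  have h1 : IntegrableOn (fun u : ℝ => u ^ (-(α / 2))) (Set.Ioi a) :=
    integrableOn_Ioi_rpow_of_lt (by linarith) ha
  refine h1.mono' (Measurable.aestronglyMeasurable (by fun_prop)) ?_
  filter_upwards [ae_restrict_mem measurableSet_Ioi] with u hu
  have hu' : 0 < u := ha.trans hu
  have hp : 0 < u ^ (α / 2) := Real.rpow_pos_of_pos hu' _
  rw [Real.norm_of_nonneg (by positivity), Real.rpow_neg hu'.le, ← one_div]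
  exact one_div_le_one_div_of_le hp (by linarith)

lemma continuousAt_rho (hα : 2 < α) {x : ℝ} (hx : 0 < x) : ContinuousAt (rho α) x := by
  have hF : ContinuousOn (fun a : ℝ => ∫ u in Set.Ioi a, 1 / (1 + u ^ (α / 2))) (Set.Ioi 0) := by
    intro a ha
    have ha' : 0 < a / 2 := half_pos ha
    exact ((integrableOn_one_div_one_add_rpow hα ha').continuousOn_Ici_primitive_Ioi.continuousAt
      (Ici_mem_nhds (half_lt_self ha))).continuousWithinAt
  have h1 : ContinuousAt (fun x : ℝ => x ^ (-(2 / α))) x :=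
    Real.continuousAt_rpow_const _ _ (Or.inl hx.ne')
  have h2 : ContinuousAt (fun x : ℝ => ∫ u in Set.Ioi (x ^ (-(2 / α))), 1 / (1 + u ^ (α / 2))) x :=
    ContinuousAt.comp (g := fun a : ℝ => ∫ u in Set.Ioi a, 1 / (1 + u ^ (α / 2)))
      (hF.continuousAt (Ioi_mem_nhds (Real.rpow_pos_of_pos hx _))) h1
  exact (Real.continuousAt_rpow_const _ _ (Or.inl hx.ne')).mul h2

/-- The substitution `u = x ^ (-2/α) (s / r) ^ 2` in the integral that defines `rho`. -/
lemma integral_Ioi_mul_pathLoss (hα : 2 < α) {x r : ℝ} (hx : 0 < x) (hr : 0 < r) :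
    IntegrableOn (fun s : ℝ => s * (1 - (1 + x * (r / s) ^ α)⁻¹)) (Set.Ioi r) ∧
      ∫ s in Set.Ioi r, s * (1 - (1 + x * (r / s) ^ α)⁻¹) = r ^ 2 / 2 * rho α x := by
  set κ : ℝ := x ^ (-(2 / α)) / r ^ 2 with hκ
  have hκ0 : 0 < κ := by positivity
  set f : ℝ → ℝ := fun s => κ * s ^ 2 with hf
  have hderiv : ∀ s ∈ Set.Ioi r, HasDerivWithinAt f (κ * (2 * s)) (Set.Ioi r) s := fun s _ => by
    simpa using ((hasDerivAt_pow 2 s).const_mul κ).hasDerivWithinAt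
  have hinj : Set.InjOn f (Set.Ioi r) := by
    intro s hs t ht hst
    have hs' : 0 < s := hr.trans hs
    have ht' : 0 < t := hr.trans ht
    have : s ^ 2 = t ^ 2 := mul_left_cancel₀ hκ0.ne' hst
    exact (pow_left_inj₀ hs'.le ht'.le two_ne_zero).1 this
  have himage : f '' Set.Ioi r = Set.Ioi (x ^ (-(2 / α))) := by
    ext u
    constructor
    · rintro ⟨s, hs, rfl⟩
      have : r ^ 2 < s ^ 2 := pow_lt_pow_left₀ hs hr.le two_ne_zero
      have h2 : x ^ (-(2 / α)) = κ * r ^ 2 := by rw [hκ]; field_simp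
      rw [Set.mem_Ioi, h2]
      exact mul_lt_mul_of_pos_left this hκ0
    · intro hu
      have hu0 : 0 < u := (Real.rpow_pos_of_pos hx _).trans hu
      refine ⟨Real.sqrt (u / κ), ?_, ?_⟩
      · refine Real.lt_sqrt_of_sq_lt ?_
        rw [lt_div_iff₀ hκ0, hκ]
        have : r ^ 2 * (x ^ (-(2 / α)) / r ^ 2) = x ^ (-(2 / α)) := by field_simp
        rw [this]; exact hu
      · simp only [hf]
        rw [Real.sq_sqrt (by positivity)]
        field_simp
  have hint := integrableOn_one_div_one_add_rpow hα (Real.rpow_pos_of_pos hx (-(2 / α)))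
  have heq : Set.EqOn (fun s => |κ * (2 * s)| • (1 / (1 + f s ^ (α / 2))))
      (fun s => 2 * κ * (s * (1 - (1 + x * (r / s) ^ α)⁻¹))) (Set.Ioi r) := by
    intro s hs
    have hs' : 0 < s := hr.trans hs
    have hα' : α ≠ 0 := by linarith
    have h1 : f s ^ (α / 2) = x⁻¹ * ((r / s) ^ α)⁻¹ := by
      have e1 : f s = x ^ (-(2 / α)) * ((r / s)⁻¹) ^ 2 := by
        simp only [hf, hκ]; field_simp
      rw [e1, Real.mul_rpow (by positivity) (by positivity), ← Real.rpow_mul hx.le,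
        ← Real.rpow_natCast ((r / s)⁻¹) 2, ← Real.rpow_mul (by positivity)]
      have e2 : -(2 / α) * (α / 2) = -1 := by field_simp
      have e3 : ((2 : ℕ) : ℝ) * (α / 2) = α := by push_cast; ring
      rw [e2, e3, Real.rpow_neg_one, Real.inv_rpow (by positivity)]
    have hv : 0 < (r / s) ^ α := by positivity
    simp only [smul_eq_mul]
    rw [h1, abs_of_pos (by positivity)]
    field_simp
    ring
  have hint' := (integrableOn_image_iff_integrableOn_abs_deriv_smul measurableSet_Ioi hderiv hinj
    (fun u : ℝ => 1 / (1 + u ^ (α / 2)))).1 (by rw [himage]; exact hint)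
  have hval := integral_image_eq_integral_abs_deriv_smul measurableSet_Ioi hderiv hinj
    (fun u : ℝ => 1 / (1 + u ^ (α / 2)))
  rw [himage, setIntegral_congr_fun measurableSet_Ioi heq, integral_const_mul] at hval
  rw [integrableOn_congr_fun heq measurableSet_Ioi] at hint'
  constructor
  · have h2 := hint'.const_mul (2 * κ)⁻¹
    refine (integrableOn_congr_fun (fun s _ => ?_) measurableSet_Ioi).1 h2
    field_simp
  · rw [rho, hval, hκ, Real.rpow_neg hx.le]
    have : 0 < x ^ (2 / α) := by positivity
    field_simp

/-- The exponent of the Laplace functional of the interference from outside the disc of radius `r`,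
computed in polar coordinates. -/
lemma lintegral_one_sub_negExp_pathLoss (hα : 2 < α) {x r : ℝ} (hx : 0 < x) (hr : 0 < r)
    (z : EuclideanSpace ℝ (Fin 2)) :
    ∫⁻ y, (1 - negExp (if r < dist z y then
        ENNReal.ofReal (Real.log (1 + x * (r / dist z y) ^ α)) else 0)) =
      ENNReal.ofReal (Real.pi * r ^ 2 * rho α x) := by
  obtain ⟨hint, hval⟩ := integral_Ioi_mul_pathLoss hα hx hr
  set f : ℝ → ℝ := (Set.Ioi r).indicator fun s => 1 - (1 + x * (r / s) ^ α)⁻¹ with hf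
  have hdim : Module.finrank ℝ (EuclideanSpace ℝ (Fin 2)) = 2 := by simp
  have hf0 : ∀ s, 0 ≤ f s := by
    intro s
    refine Set.indicator_nonneg (fun s hs => ?_) s
    have hs' : 0 < s := hr.trans hs
    have : (1 + x * (r / s) ^ α)⁻¹ ≤ 1 := inv_le_one_of_one_le₀ (by
      have : 0 ≤ x * (r / s) ^ α := by positivity
      linarith)
    linarith
  have hind : (fun s : ℝ => s ^ (2 - 1) • f s) =
      (Set.Ioi r).indicator fun s => s * (1 - (1 + x * (r / s) ^ α)⁻¹) := by
    funext s
    by_cases hs : s ∈ Set.Ioi r <;> simp [hf, hs]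
  have hpt : ∀ y : EuclideanSpace ℝ (Fin 2), 1 - negExp (if r < dist z y then
      ENNReal.ofReal (Real.log (1 + x * (r / dist z y) ^ α)) else 0) =
      ENNReal.ofReal (f ‖y - z‖) := by
    intro y
    rw [dist_comm, dist_eq_norm]
    split_ifs with hs
    · have hp : 0 ≤ x * (r / ‖y - z‖) ^ α := by positivity
      rw [negExp_ofReal_log (by linarith), hf,
        Set.indicator_of_mem (show ‖y - z‖ ∈ Set.Ioi r from hs), ← ENNReal.ofReal_one,
        ← ENNReal.ofReal_sub _ (by positivity)]
    · rw [hf, Set.indicator_of_notMem (show ‖y - z‖ ∉ Set.Ioi r from hs)]; simp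
  have hIoi : Set.Ioi r ∩ Set.Ioi (0 : ℝ) = Set.Ioi r :=
    Set.inter_eq_left.2 (Set.Ioi_subset_Ioi hr.le)
  have hint2 : Integrable (fun y : EuclideanSpace ℝ (Fin 2) => f ‖y‖) := by
    rw [integrable_fun_norm_addHaar, hdim, hind, IntegrableOn,
      integrable_indicator_iff measurableSet_Ioi, IntegrableOn,
      Measure.restrict_restrict measurableSet_Ioi, hIoi]
    exact hint
  simp_rw [hpt]
  rw [lintegral_sub_right_eq_self (fun y => ENNReal.ofReal (f ‖y‖)) z,
    ← ofReal_integral_eq_lintegral_ofReal hint2 (ae_of_all _ fun y => hf0 _),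
    integral_fun_norm_addHaar, hdim, hind, integral_indicator measurableSet_Ioi,
    Measure.restrict_restrict measurableSet_Ioi, hIoi, hval, measureReal_def,
    EuclideanSpace.volume_ball_fin_two]
  congr 1
  simp [Real.pi_pos.le]
  ring

end Radial

/-! ### The conditional law of the capacity, integrated over events of the serving distance -/

section Coverage

variable {Ω : Type*} {P α σ : ℝ} {z : EuclideanSpace ℝ (Fin 2)}
  {b : ℕ → Ω → EuclideanSpace ℝ (Fin 2)} {h : ℕ → Ω → ℝ}

/-- The capacity is at least `t` if and only if the fading of the serving link exceeds the noise
plus the interference, in units of the mean power of the serving link and scaled by `2 ^ t - 1`. -/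
lemma le_linkCapacity_iff (hP : 0 < P) {ω : Ω} (hgen : IsGenericConfig z fun i => b i ω)
    (hpos : ∀ i, 0 < h i ω) {t : ℝ} (ht : 0 < t) :
    t ≤ linkCapacity P α σ z b h ω ↔
      ENNReal.ofReal ((2 ^ t - 1) * servingDist z b ω ^ α * σ ^ 2 / P) +
        (∑' i, if i = servingIndex z b ω then 0 else ENNReal.ofReal
          ((2 ^ t - 1) * (servingDist z b ω / dist z (b i ω)) ^ α * h i ω)) ≤
        ENNReal.ofReal (h (servingIndex z b ω) ω) := by
  set k := servingIndex z b ω with hk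
  set R := servingDist z b ω with hR
  have hR0 : 0 < R := hgen.servingDist_pos
  set x : ℝ := 2 ^ t - 1 with hx
  have hx0 : 0 < x := sub_pos.2 (Real.one_lt_rpow one_lt_two ht)
  set D := ENNReal.ofReal (σ ^ 2) + interference P α z b h ω with hD
  have hrx : ∀ i, 0 < rxPower P α z b h i ω := fun i =>
    mul_pos (mul_pos hP (hpos i)) (Real.rpow_pos_of_pos (hgen.dist_pos i) _)
  have hD0 : D ≠ 0 := by
    have hle : ENNReal.ofReal (rxPower P α z b h (k + 1) ω) ≤ interference P α z b h ω := by
      refine le_trans (le_of_eq ?_) (ENNReal.le_tsum (k + 1))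
      rw [if_neg (by omega)]
    have h1 : 0 < ENNReal.ofReal (rxPower P α z b h (k + 1) ω) := ENNReal.ofReal_pos.2 (hrx _)
    exact (h1.trans_le (hle.trans le_add_self)).ne'
  have hnum : ENNReal.ofReal (rxPower P α z b h k ω) ≠ 0 := (ENNReal.ofReal_pos.2 (hrx k)).ne'
  have hs : sinr P α σ z b h ω ≠ ∞ := ENNReal.div_ne_top ENNReal.ofReal_ne_top hD0
  have h1 : t ≤ linkCapacity P α σ z b h ω ↔
      ENNReal.ofReal x * D ≤ ENNReal.ofReal (rxPower P α z b h k ω) := by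
    rw [linkCapacity, Real.le_logb_iff_rpow_le one_lt_two (by positivity),
      ← ENNReal.le_div_iff_mul_le (Or.inr hnum) (Or.inr ENNReal.ofReal_ne_top),
      ENNReal.ofReal_le_iff_le_toReal (b := ENNReal.ofReal (rxPower P α z b h k ω) / D) hs, hx,
      sub_le_iff_le_add']
    rfl
  have hm0 : 0 < R ^ α / P := by positivity
  have hmul : ENNReal.ofReal (R ^ α / P) * ENNReal.ofReal (rxPower P α z b h k ω) =
      ENNReal.ofReal (h k ω) := by
    rw [← ENNReal.ofReal_mul hm0.le, rxPower]
    congr 1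
    change R ^ α / P * (P * h k ω * R ^ (-α)) = _
    rw [Real.rpow_neg hR0.le]
    have : 0 < R ^ α := by positivity
    field_simp
  have hmulD : ENNReal.ofReal (R ^ α / P) * (ENNReal.ofReal x * D) =
      ENNReal.ofReal (x * R ^ α * σ ^ 2 / P) + (∑' i, if i = k then 0 else ENNReal.ofReal
          (x * (R / dist z (b i ω)) ^ α * h i ω)) := by
    rw [hD, ← mul_assoc, ← ENNReal.ofReal_mul hm0.le, mul_add,
      ← ENNReal.ofReal_mul (by positivity), interference, ← ENNReal.tsum_mul_left]
    congr 1
    · congr 1; ring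
    · refine tsum_congr fun i => ?_
      split_ifs
      · simp
      · rw [← ENNReal.ofReal_mul (by positivity), rxPower]
        congr 1
        have hd := hgen.dist_pos i
        rw [Real.rpow_neg hd.le, Real.div_rpow hR0.le hd.le]
        have : 0 < dist z (b i ω) ^ α := by positivity
        field_simp
  rw [h1, ← hmul, ← hmulD]
  exact (ENNReal.mul_le_mul_iff_right (ENNReal.ofReal_pos.2 hm0).ne' ENNReal.ofReal_ne_top).symm

variable [MeasurableSpace Ω] {μ : Measure Ω} {lam : ℝ≥0}

lemma IsRayleighFading.ae_pos (hh : IsRayleighFading h b μ) : ∀ᵐ ω ∂μ, ∀ i, 0 < h i ω := by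
  rw [ae_all_iff]
  intro i
  have h0 : expMeasure 1 (Set.Iic 0) = 0 := by
    have := isProbabilityMeasure_expMeasure zero_lt_one
    rw [← ofReal_cdf (expMeasure 1) 0, cdf_expMeasure_eq zero_lt_one]
    simp
  rw [← (hh.hasLaw i).map_eq, Measure.map_apply (hh.measurable i) measurableSet_Iic] at h0
  filter_upwards [compl_mem_ae_iff.2 h0] with ω hω using not_le.1 hω

variable [IsProbabilityMeasure μ]

/-- Averaging over the fading with the positions of the base stations fixed, which is possible by
their independence, turns the event `t ≤ C` into the exponential of noise plus interference. -/
lemma measure_servingDist_mem_le_linkCapacity (hP : 0 < P)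
    (hb : IsHomogeneousPPP b lam μ) (hh : IsRayleighFading h b μ) {t : ℝ} (ht : 0 < t)
    {B : Set ℝ} (hB : MeasurableSet B) :
    μ {ω | servingDist z b ω ∈ B ∧ t ≤ linkCapacity P α σ z b h ω} =
      ∫⁻ ω, B.indicator (fun r => negExp (ENNReal.ofReal ((2 ^ t - 1) * r ^ α * σ ^ 2 / P)))
        (servingDist z b ω) * negExp (∑' i, if servingDist z b ω < dist z (b i ω) then
          ENNReal.ofReal (Real.log (1 + (2 ^ t - 1) * (servingDist z b ω / dist z (b i ω)) ^ α))
          else 0) ∂μ := by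
  -- Canonical versions of the fading coefficients and of the positions on the space of sequences.
  let h' : ℕ → (ℕ → ℝ) × (ℕ → EuclideanSpace ℝ (Fin 2)) → ℝ := fun i p => p.1 i
  let b' : ℕ → (ℕ → ℝ) × (ℕ → EuclideanSpace ℝ (Fin 2)) → EuclideanSpace ℝ (Fin 2) :=
    fun i p => p.2 i
  have hh'm : ∀ i, Measurable (h' i) := fun i => (measurable_pi_apply i).comp measurable_fst
  have hb'm : ∀ i, Measurable (b' i) := fun i => (measurable_pi_apply i).comp measurable_snd
  set U : Set ((ℕ → ℝ) × (ℕ → EuclideanSpace ℝ (Fin 2))) :=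
    {p | servingDist z b' p ∈ B ∧ t ≤ linkCapacity P α σ z b' h' p} with hU
  have hUm : MeasurableSet U := (measurable_servingDist hb'm z hB).inter
    (measurableSet_le measurable_const (measurable_linkCapacity hb'm hh'm P α σ z))
  have hHm : Measurable fun ω i => h i ω := measurable_pi_lambda _ hh.measurable
  have hBm : Measurable fun ω i => b i ω := measurable_pi_lambda _ hb.measurable
  have hprod := (indepFun_iff_map_prod_eq_prod_map_map hHm.aemeasurable hBm.aemeasurable).1
    hh.indep_positions
  have hprobH : IsProbabilityMeasure (μ.map fun ω i => h i ω) :=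
    Measure.isProbabilityMeasure_map hHm.aemeasurable
  have hprobB : IsProbabilityMeasure (μ.map fun ω i => b i ω) :=
    Measure.isProbabilityMeasure_map hBm.aemeasurable
  have hx0 : 0 < (2 : ℝ) ^ t - 1 := sub_pos.2 (Real.one_lt_rpow one_lt_two ht)
  calc μ {ω | servingDist z b ω ∈ B ∧ t ≤ linkCapacity P α σ z b h ω}
      = (μ.map fun ω => ((fun i => h i ω), fun i => b i ω)) U := by
        rw [Measure.map_apply (hHm.prodMk hBm) hUm]; rfl
    _ = ∫⁻ ω, μ {ω' | ((fun i => h i ω'), fun i => b i ω) ∈ U} ∂μ := by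
        rw [hprod, Measure.prod_apply_symm hUm,
          lintegral_map (measurable_measure_prodMk_right hUm) hBm]
        refine lintegral_congr fun ω => ?_
        rw [Measure.map_apply hHm (measurable_prodMk_right hUm)]
        rfl
    _ = _ := by
        refine lintegral_congr_ae ?_
        filter_upwards [hb.ae_isGenericConfig z] with ω hω
        by_cases hRB : servingDist z b ω ∈ B
        · rw [Set.indicator_of_mem hRB, ← negExp_add]
          have h1 : ∀ i, (if servingDist z b ω < dist z (b i ω) then ENNReal.ofReal
              (Real.log (1 + (2 ^ t - 1) * (servingDist z b ω / dist z (b i ω)) ^ α)) else 0) =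
              if i = servingIndex z b ω then 0 else ENNReal.ofReal
              (Real.log (1 + (2 ^ t - 1) * (servingDist z b ω / dist z (b i ω)) ^ α)) := by
            intro i
            by_cases hi : i = servingIndex z b ω
            · rw [if_pos hi, if_neg fun h2 => (hω.servingDist_lt_iff i).1 h2 hi]
            · rw [if_neg hi, if_pos ((hω.servingDist_lt_iff i).2 hi)]
          simp_rw [h1]
          rw [← hh.measure_tsum_le (servingIndex z b ω) _ (fun i => by
            have := hω.servingDist_pos
            positivity)]
          refine measure_congr ?_
          filter_upwards [hh.ae_pos] with ω' hω'
          have h2 := le_linkCapacity_iff (P := P) (α := α) (σ := σ) (b := b') (h := h') hP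
            (ω := ((fun i => h i ω'), fun i => b i ω)) hω hω' ht
          refine propext ⟨fun h3 => h2.1 h3.2, fun h3 => ⟨hRB, h2.2 h3⟩⟩
        · rw [Set.indicator_of_notMem hRB, zero_mul]
          have : {ω' | ((fun i => h i ω'), fun i => b i ω) ∈ U} = ∅ :=
            Set.eq_empty_of_forall_notMem fun ω' h1 => hRB h1.1
          rw [this, measure_empty]

/-- Joint law of the serving distance and of the event that the capacity is at least `t`. -/
lemma measure_servingDist_mem_le_linkCapacity_eq (hP : 0 < P) (hα : 2 < α)
    (hb : IsHomogeneousPPP b lam μ) (hh : IsRayleighFading h b μ) {t : ℝ} (ht : 0 < t)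
    {B : Set ℝ} (hB : MeasurableSet B) :
    μ {ω | servingDist z b ω ∈ B ∧ t ≤ linkCapacity P α σ z b h ω} =
      ∫⁻ r in B, ENNReal.ofReal (Real.exp (-((2 ^ t - 1) * r ^ α * σ ^ 2 / P)
            - Real.pi * (lam : ℝ) * r ^ 2 * rho α (2 ^ t - 1))) ∂(μ.map (servingDist z b)) := by
  have hx0 : 0 < (2 : ℝ) ^ t - 1 := sub_pos.2 (Real.one_lt_rpow one_lt_two ht)
  have hα0 : 0 ≤ α := by linarith
  have hrho : 0 ≤ rho α (2 ^ t - 1) := by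
    refine mul_nonneg (by positivity) (setIntegral_nonneg measurableSet_Ioi fun u hu => ?_)
    have hu' : 0 < u := (Real.rpow_pos_of_pos hx0 _).trans hu
    positivity
  have hRm := measurable_servingDist hb.measurable z
  rw [measure_servingDist_mem_le_linkCapacity hP hb hh ht hB,
    hb.laplace_given_servingDist z (K := fun r y =>
      ENNReal.ofReal (Real.log (1 + (2 ^ t - 1) * (r / dist z y) ^ α)))
      (w := B.indicator fun r => negExp (ENNReal.ofReal ((2 ^ t - 1) * r ^ α * σ ^ 2 / P))),
    ← lintegral_indicator hB, lintegral_map _ hRm]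
  · refine lintegral_congr_ae ?_
    filter_upwards [hb.ae_isGenericConfig z] with ω hω
    have hR0 := hω.servingDist_pos
    rw [lintegral_one_sub_negExp_pathLoss hα hx0 hR0 z]
    by_cases hRB : servingDist z b ω ∈ B
    · rw [Set.indicator_of_mem hRB, Set.indicator_of_mem hRB, ← ENNReal.ofReal_coe_nnreal,
        ← ENNReal.ofReal_mul lam.coe_nonneg, negExp_ofReal (by positivity),
        negExp_ofReal (by positivity), ← ENNReal.ofReal_mul (by positivity), ← Real.exp_add]
      congr 2; ring
    · rw [Set.indicator_of_notMem hRB, Set.indicator_of_notMem hRB, zero_mul]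
  · exact Measurable.indicator (by fun_prop) hB
  · exact ENNReal.measurable_ofReal.comp (Real.measurable_log.comp (by fun_prop))
  · intro y r hr s hs hrs
    have hr' : (0 : ℝ) ≤ r := hr
    refine ENNReal.ofReal_le_ofReal (Real.log_le_log (by positivity) ?_)
    gcongr
  · intro y r hr
    have h1 : Continuous fun r : ℝ => 1 + (2 ^ t - 1) * (r / dist z y) ^ α :=
      continuous_const.add (continuous_const.mul
        ((Real.continuous_rpow_const hα0).comp (continuous_id.div_const _)))
    have h2 : 0 < 1 + (2 ^ t - 1) * (r / dist z y) ^ α := by positivity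
    exact ENNReal.continuous_ofReal.continuousAt.comp (h1.continuousAt.log h2.ne')
  · refine Measurable.indicator (measurable_negExp.comp ?_) hB
    fun_prop
  · exact fun r => Set.indicator_apply_le' (fun _ => negExp_le_one _) (fun _ => zero_le_one)

end Coverage

/-! ### The conditional distribution -/

lemma linkCapacity_nonneg {Ω : Type*} (P α σ : ℝ) (z : EuclideanSpace ℝ (Fin 2))
    (b : ℕ → Ω → EuclideanSpace ℝ (Fin 2)) (h : ℕ → Ω → ℝ) (ω : Ω) :
    0 ≤ linkCapacity P α σ z b h ω :=
  Real.logb_nonneg one_lt_two (le_add_of_nonneg_right ENNReal.toReal_nonneg)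

/-- A conditional tail probability is determined by its integrals over events of the conditioning
variable. -/
lemma condDistrib_apply_ae_eq {Ω : Type*} [MeasurableSpace Ω] {μ : Measure Ω}
    [IsProbabilityMeasure μ] {X Y : Ω → ℝ} (hX : Measurable X) (hY : Measurable Y) {s : Set ℝ}
    (hs : MeasurableSet s) {f : ℝ → ℝ≥0∞} (hf : Measurable f)
    (hint : ∀ B, MeasurableSet B → μ (X ⁻¹' B ∩ Y ⁻¹' s) = ∫⁻ r in B, f r ∂(μ.map X)) :
    ∀ᵐ r ∂(μ.map X), condDistrib Y X μ r s = f r := by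
  have : IsProbabilityMeasure (μ.map X) := Measure.isProbabilityMeasure_map hX.aemeasurable
  have hκ : Measurable fun r => condDistrib Y X μ r s := Kernel.measurable_coe _ hs
  refine ae_eq_of_forall_setLIntegral_eq_of_sigmaFinite hκ hf fun B hB _ => ?_
  rw [← hint B hB, ← setLIntegral_preimage_condDistrib hX hY.aemeasurable hs hB,
    setLIntegral_map hB hκ hX]

theorem lemma3 {Ω : Type*} [MeasurableSpace Ω] (μ : Measure Ω) [IsProbabilityMeasure μ]
    (lam : ℝ≥0) (hlam : 0 < lam) (P α σ : ℝ) (hP : 0 < P) (hα : 2 < α)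
    (z : EuclideanSpace ℝ (Fin 2))
    (b : ℕ → Ω → EuclideanSpace ℝ (Fin 2)) (hb : IsHomogeneousPPP b lam μ)
    (h : ℕ → Ω → ℝ) (hh : IsRayleighFading h b μ) :
    Measurable (servingDist z b) ∧ Measurable (linkCapacity P α σ z b h) ∧
      ∀ᵐ r₁ ∂(μ.map (servingDist z b)), ∀ t : ℝ, 0 ≤ t →
        (condDistrib (linkCapacity P α σ z b h) (servingDist z b) μ r₁).real (Set.Ici t) =
          Real.exp (-((2 ^ t - 1) * r₁ ^ α * σ ^ 2 / P)
            - Real.pi * (lam : ℝ) * r₁ ^ 2 * rho α (2 ^ t - 1)) := by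
  have hRm := measurable_servingDist hb.measurable z
  have hCm := measurable_linkCapacity hb.measurable hh.measurable P α σ z
  refine ⟨hRm, hCm, ?_⟩
  have hrat : ∀ᵐ r ∂(μ.map (servingDist z b)), ∀ q : ℚ, (0 : ℝ) < q →
      condDistrib (linkCapacity P α σ z b h) (servingDist z b) μ r (Set.Ici (q : ℝ)) =
        ENNReal.ofReal (Real.exp (-((2 ^ (q : ℝ) - 1) * r ^ α * σ ^ 2 / P)
            - Real.pi * (lam : ℝ) * r ^ 2 * rho α (2 ^ (q : ℝ) - 1))) := by
    rw [ae_all_iff]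
    intro q
    by_cases hq : (0 : ℝ) < q
    · filter_upwards [condDistrib_apply_ae_eq hRm hCm measurableSet_Ici (by fun_prop)
        fun B hB => measure_servingDist_mem_le_linkCapacity_eq hP hα hb hh hq hB]
        with r hr _ using hr
    · exact ae_of_all _ fun r hr => absurd hr hq
  have hzero : ∀ᵐ r ∂(μ.map (servingDist z b)),
      condDistrib (linkCapacity P α σ z b h) (servingDist z b) μ r (Set.Ici 0) = 1 := by
    refine condDistrib_apply_ae_eq hRm hCm measurableSet_Ici measurable_const fun B hB => ?_
    rw [setLIntegral_one, Measure.map_apply hRm hB, Set.inter_eq_left.2]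
    exact fun ω _ => linkCapacity_nonneg P α σ z b h ω
  filter_upwards [hrat, hzero] with r hr h0 t ht
  rcases ht.eq_or_lt with rfl | ht
  · rw [measureReal_def, h0]
    have h2 : (2 / α : ℝ) ≠ 0 := by positivity
    simp [rho, Real.zero_rpow h2]
  -- The positive rationals below `t` determine the value at `t`, as both sides are left-continuous.
  obtain ⟨u, hu, hmem, hlim⟩ := 
    Dense.exists_seq_strictMono_tendsto_of_lt (Rat.denseRange_cast (𝕜 := ℝ)) ht
  have hInter : Set.Ici t = ⋂ n, Set.Ici (u n) := by
    ext s
    simp only [Set.mem_Ici, Set.mem_iInter]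
    exact ⟨fun hs n => (hmem n).1.2.le.trans hs, fun hs => le_of_tendsto' hlim hs⟩
  have hleft : Filter.Tendsto (fun n => (condDistrib (linkCapacity P α σ z b h) (servingDist z b) μ
      r).real (Set.Ici (u n))) Filter.atTop
      (nhds ((condDistrib (linkCapacity P α σ z b h) (servingDist z b) μ r).real (Set.Ici t))) := by
    rw [hInter]
    exact (ENNReal.tendsto_toReal (measure_ne_top _ _)).comp (tendsto_measure_iInter_atTop
      (fun n => measurableSet_Ici.nullMeasurableSet)
      (fun m n hmn => Set.Ici_subset_Ici.2 (hu.monotone hmn)) ⟨0, measure_ne_top _ _⟩)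
  have hpow : ContinuousAt (fun t : ℝ => (2 : ℝ) ^ t - 1) t :=
    (Real.continuous_const_rpow two_ne_zero).continuousAt.sub continuousAt_const
  have hrho : ContinuousAt (fun t : ℝ => rho α (2 ^ t - 1)) t :=
    ContinuousAt.comp (g := rho α)
      (continuousAt_rho hα (sub_pos.2 (Real.one_lt_rpow one_lt_two ht))) hpow
  have hright : ContinuousAt (fun t : ℝ => Real.exp (-((2 ^ t - 1) * r ^ α * σ ^ 2 / P)
      - Real.pi * (lam : ℝ) * r ^ 2 * rho α (2 ^ t - 1))) t :=
    ((((hpow.mul_const _).mul_const _).div_const _).neg.sub (hrho.const_mul _)).rexp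
  refine tendsto_nhds_unique hleft ((hright.tendsto.comp hlim).congr fun n => ?_)
  obtain ⟨⟨hpos, -⟩, q, hq⟩ := hmem n
  have := hr q (by rw [hq]; exact hpos)
  rw [hq] at this
  rw [measureReal_def, this, ENNReal.toReal_ofReal (Real.exp_pos _).le]
  rfl
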